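/- Let $A\in\mathbb R^{n\times n}$, $B\in\mathbb R^{n\times m}$ with $B\neq 0$, $C\in\mathbb R^{p\times n}$, let $Q\in\mathbb R^{p\times p}$ and $R\in\mathbb R^{m\times m}$ be symmetric positive definite, and let $\bar A\in\mathbb R^{\bar n\times\bar n}$, $\bar C\in\mathbb R^{p\times\bar n}$. Consider the agent $\dot x=Ax+Bu$, $y=Cx$, and the exosystem $\bar x(t)=e^{\bar A t}\bar x(0)$ with reference output $\bar y=\bar C\bar x$. Put $\tilde y=y-\bar y$ and $$J_{t_f}(\tilde y,u)=\tfrac12\int_0^{t_f}\big(\tilde y(t)^{\top}Q\,\tilde y(t)+u(t)^{\top}R\,u(t)\big)\,dt\in[0,\infty].$$ Assume that $(A,B)$ is stabilizable, that $(A,C)$ is detectable, and that every (complex) eigenvalue of $\bar A$ is semisimple and has zero real part. Let $K\in\mathbb R^{m\times n}$ be any matrix such that $A-BK$ is Hurwitz. A pair $(\Pi,\Gamma)\in\mathbb R^{n\times\bar n}\times\mathbb R^{m\times\bar n}$ is said to achieve *optimal stationary synchronization* for all initial states if $\Pi\bar A=A\Pi+B\Gamma$ and the following holds for all $\bar x(0)\in\mathbb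 R^{\bar n}$ and $x_0\in\mathbb R^n$. Let $x^*$ be the trajectory of the agent with $x^*(0)=x_0$ under the control $u^*=-K(x^*-\Pi\bar x)+\Gamma\bar x$, and let $\tilde y^*=Cx^*-\bar y$. Then for every locally integrable control $\hat u:[0,\infty)\to\mathbb R^m$, with trajectory $\hat x$, $\hat x(0)=x_0$, and error $\hat{\tilde y}=C\hat x-\bar y$, such that $\hat x(t)-\Pi\bar x(t)$ does not converge to $0$ as $t\to\infty$, one has $$\lim_{t_f\to\infty}\Big(J_{t_f}(\hat{\tilde y},\hat u)-J_{t_f}(\tilde y^*,u^*)\Big)=+\infty .$$ Then the system of equations $$\begin{pmatrix}\Pi\\ \Pi_\lambda\end{pmatrix}\bar A=\begin{pmatrix}A&-BR^{-1}B^{\top}\\-C^{\top}QC&-A^{\top}\end{pmatrix}\begin{pmatrix}\Pi\\ \Pi_\lambda\end{pmatrix}+\begin{pmatrix}0\\ C^{\top}Q\bar C\end{pmatrix},\qquad \Gamma=-R^{-1}B^{\top}\Pi_\lambda$$ has exactly one solution $(\Pi,\Pi_\lambda,\Gamma)$ with $\Pi,\Pi_\lambda\in\mathbb R^{n\times\bar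 n}$, $\Gamma\in\mathbb R^{m\times\bar n}$. Moreover, a pair $(\Pi,\Gamma)$ achieves optimal stationary synchronization for all initial states if and only if it is the $(\Pi,\Gamma)$-part of this solution. -/

import Mathlib

open MeasureTheory Filter Topology Matrix

noncomputable section

namespace OptSync

/-- A real square matrix is Hurwitz: all its complex eigenvalues have negative real part. -/
def IsHurwitz {n : ℕ} (A : Matrix (Fin n) (Fin n) ℝ) : Prop :=
  ∀ μ ∈ spectrum ℂ (A.map (algebraMap ℝ ℂ)), μ.re < 0

/-- `(A, B)` is stabilizable: some static state feedback makes the closed loop Hurwitz. -/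
def IsStabilizable {n m : ℕ} (A : Matrix (Fin n) (Fin n) ℝ) (B : Matrix (Fin n) (Fin m) ℝ) :
    Prop :=
  ∃ F : Matrix (Fin m) (Fin n) ℝ, IsHurwitz (A + B * F)

/-- `(A, C)` is detectable: some output injection makes the error dynamics Hurwitz. -/
def IsDetectable {n p : ℕ} (A : Matrix (Fin n) (Fin n) ℝ) (C : Matrix (Fin p) (Fin n) ℝ) :
    Prop :=
  ∃ L : Matrix (Fin n) (Fin p) ℝ, IsHurwitz (A + L * C)

/-- Every complex eigenvalue of the real matrix `S` has zero real part and is semisimple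
(its generalized eigenspace is its eigenspace). -/
def HasSemisimpleImaginarySpectrum {q : ℕ} (S : Matrix (Fin q) (Fin q) ℝ) : Prop :=
  ∀ μ : ℂ, Module.End.HasEigenvalue (Matrix.toLin' (S.map (algebraMap ℝ ℂ))) μ →
    μ.re = 0 ∧
      Module.End.maxGenEigenspace (Matrix.toLin' (S.map (algebraMap ℝ ℂ))) μ =
        Module.End.eigenspace (Matrix.toLin' (S.map (algebraMap ℝ ℂ))) μ

/-- The exosystem state `w(t) = exp(S t) w₀`. -/
def exoState {q : ℕ} (S : Matrix (Fin q) (Fin q) ℝ) (w₀ : Fin q → ℝ) (t : ℝ) : Fin q → ℝ :=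
  NormedSpace.exp (t • S) *ᵥ w₀

/-- `u` is a control on `[0, ∞)` (integrable on bounded intervals) and `x` is the (Carathéodory)
solution on `[0, ∞)` of `x' = A x + B u`, `x(0) = x₀`. -/
structure IsTrajectory {n m : ℕ} (A : Matrix (Fin n) (Fin n) ℝ) (B : Matrix (Fin n) (Fin m) ℝ)
    (x₀ : Fin n → ℝ) (u : ℝ → Fin m → ℝ) (x : ℝ → Fin n → ℝ) : Prop where
  control_integrable : ∀ T : ℝ, 0 ≤ T → IntervalIntegrable u volume 0 T
  state_continuous : ContinuousOn x (Set.Ici 0)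
  state_eq : ∀ t : ℝ, 0 ≤ t → x t = x₀ + ∫ s in (0 : ℝ)..t, (A *ᵥ x s + B *ᵥ u s)

/-- The quadratic cost `½ ∫₀^T eᵀ Q e + uᵀ R u dt` of an error signal `e` and a control `u`, with
value in `[0, ∞]`, so that it is meaningful for controls that are not square integrable. -/
def cost {p m : ℕ} (Q : Matrix (Fin p) (Fin p) ℝ) (R : Matrix (Fin m) (Fin m) ℝ) (T : ℝ)
    (e : ℝ → Fin p → ℝ) (u : ℝ → Fin m → ℝ) : ENNReal :=
  (1 / 2) * ∫⁻ t in Set.Icc 0 T, ENNReal.ofReal (e t ⬝ᵥ (Q *ᵥ e t) + u t ⬝ᵥ (R *ᵥ u t))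

/-- The error `C x(t) - D w(t)` between the agent's output and the reference `D w(t)`. -/
def syncError {n p q : ℕ} (C : Matrix (Fin p) (Fin n) ℝ) (D : Matrix (Fin p) (Fin q) ℝ)
    (x : ℝ → Fin n → ℝ) (w : ℝ → Fin q → ℝ) (t : ℝ) : Fin p → ℝ :=
  C *ᵥ x t - D *ᵥ w t

/-- The tracking control law `u = -K (x - P w) + G w`, evaluated along `x` and `w`. -/
def trackingControl {n m q : ℕ} (K : Matrix (Fin m) (Fin n) ℝ) (P : Matrix (Fin n) (Fin q) ℝ)
    (G : Matrix (Fin m) (Fin q) ℝ) (x : ℝ → Fin n → ℝ) (w : ℝ → Fin q → ℝ) (t : ℝ) : Fin m → ℝ :=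
  -(K *ᵥ (x t - P *ᵥ w t)) + G *ᵥ w t

/-- Optimal stationary synchronization by the pair `(P, G)` and the feedback gain `K`, for every
initial state `w₀` of the exosystem `w' = S w` and every initial state `x₀` of the agent: the pair
is stationary, `P S = A P + B G`, and, if `x` is the closed-loop trajectory from `x₀` under the
tracking control, then any control `v` whose trajectory `z` from `x₀` does not approach `P w`
costs infinitely more in the limit of an infinite horizon. (The closed loop is a linear ODE, so
there is exactly one such `x`.) -/
structure IsOptimalStationarySync {n m p q : ℕ}
    (A : Matrix (Fin n) (Fin n) ℝ) (B : Matrix (Fin n) (Fin m) ℝ) (C : Matrix (Fin p) (Fin n) ℝ)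
    (Q : Matrix (Fin p) (Fin p) ℝ) (R : Matrix (Fin m) (Fin m) ℝ)
    (S : Matrix (Fin q) (Fin q) ℝ) (D : Matrix (Fin p) (Fin q) ℝ)
    (K : Matrix (Fin m) (Fin n) ℝ)
    (P : Matrix (Fin n) (Fin q) ℝ) (G : Matrix (Fin m) (Fin q) ℝ) : Prop where
  stationary : P * S = A * P + B * G
  optimal : ∀ (w₀ : Fin q → ℝ) (x₀ : Fin n → ℝ) (x : ℝ → Fin n → ℝ),
    IsTrajectory A B x₀ (trackingControl K P G x (exoState S w₀)) x →
    ∀ (v : ℝ → Fin m → ℝ) (z : ℝ → Fin n → ℝ), IsTrajectory A B x₀ v z →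
      ¬ Tendsto (fun t => z t - P *ᵥ exoState S w₀ t) atTop (𝓝 0) →
      Tendsto (fun T : ℝ =>
        ((cost Q R T (syncError C D z (exoState S w₀)) v : ENNReal) : EReal) -
          ((cost Q R T (syncError C D x (exoState S w₀))
            (trackingControl K P G x (exoState S w₀)) : ENNReal) : EReal))
        atTop (𝓝 ⊤)

/-- The Hamiltonian matrix `[[A, -B R⁻¹ Bᵀ], [-Cᵀ Q C, -Aᵀ]]`. -/
def hamiltonian {n m p : ℕ}
    (A : Matrix (Fin n) (Fin n) ℝ) (B : Matrix (Fin n) (Fin m) ℝ) (C : Matrix (Fin p) (Fin n) ℝ)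
    (Q : Matrix (Fin p) (Fin p) ℝ) (R : Matrix (Fin m) (Fin m) ℝ) :
    Matrix (Fin n ⊕ Fin n) (Fin n ⊕ Fin n) ℝ :=
  Matrix.fromBlocks A (-(B * R⁻¹ * Bᵀ)) (-(Cᵀ * Q * C)) (-Aᵀ)

/-- `(P, L, G)` solves the Hamiltonian Sylvester equation
`[P; L] S = Θ [P; L] + [0; Cᵀ Q D]` together with `G = -R⁻¹ Bᵀ L`. -/
def SolvesHamiltonianSylvester {n m p q : ℕ}
    (A : Matrix (Fin n) (Fin n) ℝ) (B : Matrix (Fin n) (Fin m) ℝ) (C : Matrix (Fin p) (Fin n) ℝ)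
    (Q : Matrix (Fin p) (Fin p) ℝ) (R : Matrix (Fin m) (Fin m) ℝ)
    (S : Matrix (Fin q) (Fin q) ℝ) (D : Matrix (Fin p) (Fin q) ℝ)
    (P L : Matrix (Fin n) (Fin q) ℝ) (G : Matrix (Fin m) (Fin q) ℝ) : Prop :=
  Matrix.fromRows P L * S =
      hamiltonian A B C Q R * Matrix.fromRows P L + Matrix.fromRows 0 (Cᵀ * Q * D) ∧
    G = -(R⁻¹ * Bᵀ * L)

end OptSync

end

/-! Subtract the stationary motion: put ξ = z − P w and ν = v − G w. If (P, L, G) solves the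
Hamiltonian Sylvester equation, the cross terms of the stage cost are an exact derivative, so the
cost of z is half the integral of the stage cost of (Cξ, ν), plus boundary terms ξᵀ L w, plus a
stationary part that is the same for all controls and cancels in differences (`stageCost_eq`,
`cost_sub_cost_eq`).

Sufficiency: the tracking control has bounded excess E and bounded boundary terms, since A − BK is
Hurwitz and w is bounded. For a competitor, detectability gives |ξ(T)|² ≤ c(|ξ(0)|² + E(T)), so the
boundary term can be absorbed into the excess and the cost gap is at least E(T)/4 + const. Bounded
excess would force ξ → 0, so a competitor not converging to P w has E → ∞.

Solvability: a kernel element of the Sylvester operator carries eigenvectors of S to eigenvectors of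
the Hamiltonian matrix with imaginary eigenvalues. By stabilizability and detectability these
vanish, and semisimplicity makes the eigenvectors of S span. Injectivity gives bijectivity in finite
dimension.

Necessity: two optimal pairs with different P would each have to be eventually strictly cheaper than
the other (`state_unique`). Stationarity then fixes only B G, so a wrong gain G' needs a separate
argument (`control_unique`): its excess grows linearly at a fixed rate, while a small constant
deviation from P w, available because B ≠ 0, grows at an arbitrarily small rate although it never
converges to P w. -/

namespace OptSync

/-! ### Linear flows with semisimple imaginary spectrum: boundedness and persistence. -/

section Exponential

variable {q : ℕ}

theorem hasDerivAt_exoState (S : Matrix (Fin q) (Fin q) ℝ) (w₀ : Fin q → ℝ) (t : ℝ) :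
    HasDerivAt (exoState S w₀) (S *ᵥ exoState S w₀ t) t := by
  let : NormedRing (Matrix (Fin q) (Fin q) ℝ) := Matrix.linftyOpNormedRing
  let : NormedAlgebra ℝ (Matrix (Fin q) (Fin q) ℝ) := Matrix.linftyOpNormedAlgebra
  have h := hasDerivAt_exp_smul_const' S t
  let ev : Matrix (Fin q) (Fin q) ℝ →ₗ[ℝ] (Fin q → ℝ) :=
    { toFun := fun M => M *ᵥ w₀
      map_add' := fun M N => Matrix.add_mulVec M N w₀
      map_smul' := fun c M => Matrix.smul_mulVec c M w₀ }
  have h2 := (LinearMap.toContinuousLinearMap ev).hasFDerivAt.comp_hasDerivAt t h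
  have h3 : S *ᵥ exoState S w₀ t = (S * NormedSpace.exp (t • S)) *ᵥ w₀ :=
    Matrix.mulVec_mulVec w₀ S (NormedSpace.exp (t • S))
  rw [h3]
  exact h2

theorem exoState_zero (S : Matrix (Fin q) (Fin q) ℝ) (w₀ : Fin q → ℝ) :
    exoState S w₀ 0 = w₀ := by
  simp [exoState]

theorem exoState_add (S : Matrix (Fin q) (Fin q) ℝ) (v w : Fin q → ℝ) (t : ℝ) :
    exoState S (v + w) t = exoState S v t + exoState S w t :=
  Matrix.mulVec_add _ _ _

theorem exoState_smul (S : Matrix (Fin q) (Fin q) ℝ) (c : ℝ) (v : Fin q → ℝ) (t : ℝ) :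
    exoState S (c • v) t = c • exoState S v t :=
  Matrix.mulVec_smul _ _ _

theorem continuous_exoState (S : Matrix (Fin q) (Fin q) ℝ) (w₀ : Fin q → ℝ) :
    Continuous (exoState S w₀) :=
  continuous_iff_continuousAt.2 fun t => (hasDerivAt_exoState S w₀ t).continuousAt

/-- A solution of the linear differential equation `y' = S y` is `exp(S t) y(0)`. -/
theorem eq_exoState_of_hasDerivAt {S : Matrix (Fin q) (Fin q) ℝ} {y : ℝ → Fin q → ℝ}
    (hy : ∀ t, HasDerivAt y (S *ᵥ y t) t) (t : ℝ) : y t = exoState S (y 0) t := by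
  let L : (Fin q → ℝ) →L[ℝ] (Fin q → ℝ) := LinearMap.toContinuousLinearMap (Matrix.toLin' S)
  have hL : ∀ v, L v = S *ᵥ v := fun v => by simp [L]
  refine congrFun (ODE_solution_unique_univ (v := fun _ => L) (s := fun _ => Set.univ)
    (K := ‖L‖₊) (t₀ := 0) (fun _ => L.lipschitz.lipschitzOnWith)
    (fun s => ⟨by simpa [hL] using hy s, trivial⟩)
    (fun s => ⟨by simpa [hL] using hasDerivAt_exoState S (y 0) s, trivial⟩)
    (exoState_zero S (y 0)).symm) t

/-- The coordinatewise real part of a complex vector. -/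
def reVec (v : Fin q → ℂ) : Fin q → ℝ := fun i => (v i).re

/-- The coordinatewise imaginary part of a complex vector. -/
def imVec (v : Fin q → ℂ) : Fin q → ℝ := fun i => (v i).im

theorem reVec_mulVec (S : Matrix (Fin q) (Fin q) ℝ) (v : Fin q → ℂ) :
    reVec (S.map (algebraMap ℝ ℂ) *ᵥ v) = S *ᵥ reVec v := by
  ext i
  simp [reVec, Matrix.mulVec, dotProduct]

theorem imVec_mulVec (S : Matrix (Fin q) (Fin q) ℝ) (v : Fin q → ℂ) :
    imVec (S.map (algebraMap ℝ ℂ) *ᵥ v) = S *ᵥ imVec v := by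
  ext i
  simp [imVec, Matrix.mulVec, dotProduct]

/-- The complex vectors whose real and imaginary parts lie in a given real subspace. -/
def complexSpan (U : Submodule ℝ (Fin q → ℝ)) : Submodule ℂ (Fin q → ℂ) where
  carrier := {v | reVec v ∈ U ∧ imVec v ∈ U}
  zero_mem' := ⟨U.zero_mem, U.zero_mem⟩
  add_mem' := fun ha hb => ⟨U.add_mem ha.1 hb.1, U.add_mem ha.2 hb.2⟩
  smul_mem' := by
    intro c v hv
    have h1 : reVec (c • v) = c.re • reVec v - c.im • imVec v := by
      ext i; simp [reVec, imVec]
    have h2 : imVec (c • v) = c.re • imVec v + c.im • reVec v := by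
      ext i; simp [reVec, imVec]
    refine ⟨?_, ?_⟩
    · rw [h1]; exact U.sub_mem (U.smul_mem _ hv.1) (U.smul_mem _ hv.2)
    · rw [h2]; exact U.add_mem (U.smul_mem _ hv.2) (U.smul_mem _ hv.1)

theorem eq_top_of_complexSpan_eq_top {U : Submodule ℝ (Fin q → ℝ)} (h : complexSpan U = ⊤) :
    U = ⊤ := by
  refine eq_top_iff.2 fun v _ => ?_
  have : (fun i => (v i : ℂ)) ∈ complexSpan U := h ▸ trivial
  exact this.1

/-- For a matrix with semisimple imaginary spectrum, the real and imaginary parts of the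
eigenvectors span. -/
theorem HasSemisimpleImaginarySpectrum.eq_top {S : Matrix (Fin q) (Fin q) ℝ}
    (hS : HasSemisimpleImaginarySpectrum S) (U : Submodule ℝ (Fin q → ℝ))
    (hU : ∀ (a b : Fin q → ℝ) (ω : ℝ), S *ᵥ a = -(ω • b) → S *ᵥ b = ω • a → a ∈ U ∧ b ∈ U) :
    U = ⊤ := by
  refine eq_top_of_complexSpan_eq_top (eq_top_iff.2 ?_)
  rw [← Module.End.iSup_maxGenEigenspace_eq_top (Matrix.toLin' (S.map (algebraMap ℝ ℂ)))]
  refine iSup_le fun μ v hv => ?_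
  by_cases hv0 : v = 0
  · rw [hv0]; exact Submodule.zero_mem _
  have hμ : Module.End.HasEigenvalue (Matrix.toLin' (S.map (algebraMap ℝ ℂ))) μ := by
    refine Module.End.hasEigenvalue_of_hasGenEigenvalue (k := Module.finrank ℂ (Fin q → ℂ)) ?_
    intro h
    rw [Module.End.maxGenEigenspace_eq_genEigenspace_finrank, h] at hv
    exact hv0 hv
  -- Semisimplicity turns the generalized eigenvector v into an eigenvector for μ = iω, whose real
  -- and imaginary parts satisfy the relations in `hU`.
  obtain ⟨hre, heq⟩ := hS μ hμ
  rw [heq, Module.End.mem_eigenspace_iff, Matrix.toLin'_apply] at hv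
  refine hU (reVec v) (imVec v) μ.im ?_ ?_
  · rw [← reVec_mulVec, hv]; ext i; simp [reVec, imVec, hre]
  · rw [← imVec_mulVec, hv]; ext i; simp [reVec, imVec, hre]

/-- The hypotheses say that a + ib is an eigenvector for iω; the formulas are the real and imaginary
parts of exp(iωt)(a + ib). -/
theorem exoState_of_eigenpair {S : Matrix (Fin q) (Fin q) ℝ} {a b : Fin q → ℝ} {ω : ℝ}
    (ha : S *ᵥ a = -(ω • b)) (hb : S *ᵥ b = ω • a) (t : ℝ) :
    exoState S a t = Real.cos (ω * t) • a - Real.sin (ω * t) • b ∧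
      exoState S b t = Real.sin (ω * t) • a + Real.cos (ω * t) • b := by
  have hid : ∀ s : ℝ, HasDerivAt (fun s => ω * s) ω s := fun s => by
    simpa using (hasDerivAt_id s).const_mul ω
  constructor
  · have := eq_exoState_of_hasDerivAt (S := S)
      (y := fun t => Real.cos (ω * t) • a - Real.sin (ω * t) • b) (fun s => by
        convert! ((hid s).cos.smul_const a).sub ((hid s).sin.smul_const b) using 1
        rw [Matrix.mulVec_sub, Matrix.mulVec_smul, Matrix.mulVec_smul, ha, hb]
        module) t
    simpa using this.symm
  · have := eq_exoState_of_hasDerivAt (S := S)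
      (y := fun t => Real.sin (ω * t) • a + Real.cos (ω * t) • b) (fun s => by
        convert! ((hid s).sin.smul_const a).add ((hid s).cos.smul_const b) using 1
        rw [Matrix.mulVec_add, Matrix.mulVec_smul, Matrix.mulVec_smul, ha, hb]
        module) t
    simpa using this.symm

/-- The trajectories of a system with semisimple imaginary spectrum are bounded. -/
theorem HasSemisimpleImaginarySpectrum.exists_norm_exoState_le {S : Matrix (Fin q) (Fin q) ℝ}
    (hS : HasSemisimpleImaginarySpectrum S) (w₀ : Fin q → ℝ) :
    ∃ c, ∀ t, ‖exoState S w₀ t‖ ≤ c := by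
  let U : Submodule ℝ (Fin q → ℝ) :=
    { carrier := {v | ∃ c, ∀ t, ‖exoState S v t‖ ≤ c}
      zero_mem' := ⟨0, fun t => by simp [exoState]⟩
      add_mem' := by
        rintro v w ⟨c, hc⟩ ⟨d, hd⟩
        refine ⟨c + d, fun t => ?_⟩
        rw [exoState_add]
        exact (norm_add_le _ _).trans (add_le_add (hc t) (hd t))
      smul_mem' := by
        rintro r v ⟨c, hc⟩
        refine ⟨‖r‖ * c, fun t => ?_⟩
        rw [exoState_smul, norm_smul]
        exact mul_le_mul_of_nonneg_left (hc t) (norm_nonneg _) }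
  have hU : U = ⊤ := by
    refine hS.eq_top U fun a b ω ha hb => ⟨⟨‖a‖ + ‖b‖, fun t => ?_⟩, ⟨‖a‖ + ‖b‖, fun t => ?_⟩⟩
    · rw [(exoState_of_eigenpair ha hb t).1]
      refine (norm_sub_le _ _).trans (add_le_add ?_ ?_) <;> rw [norm_smul] <;>
        refine mul_le_of_le_one_left (norm_nonneg _) ?_
      exacts [Real.abs_cos_le_one _, Real.abs_sin_le_one _]
    · rw [(exoState_of_eigenpair ha hb t).2]
      refine (norm_add_le _ _).trans (add_le_add ?_ ?_) <;> rw [norm_smul] <;>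
        refine mul_le_of_le_one_left (norm_nonneg _) ?_
      exacts [Real.abs_sin_le_one _, Real.abs_cos_le_one _]
  have : w₀ ∈ U := hU ▸ trivial
  exact this

/-- A nonzero matrix has persistent output along the trajectories of a system with semisimple
imaginary spectrum. -/
theorem HasSemisimpleImaginarySpectrum.exists_persistent {S : Matrix (Fin q) (Fin q) ℝ}
    (hS : HasSemisimpleImaginarySpectrum S) {k : ℕ} {M : Matrix (Fin k) (Fin q) ℝ} (hM : M ≠ 0) :
    ∃ (a b : Fin q → ℝ) (δ : ℝ), 0 < δ ∧ ∀ t,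
      (M *ᵥ exoState S a t) ⬝ᵥ (M *ᵥ exoState S a t) +
        (M *ᵥ exoState S b t) ⬝ᵥ (M *ᵥ exoState S b t) = δ := by
  by_contra! hcon
  -- Along an eigenpair the motion is a rotation, so the sum of the two squared outputs is constant
  -- in time. Were it zero for every eigenpair, M would vanish on a spanning set.
  have hU : LinearMap.ker (Matrix.toLin' M) = ⊤ := by
    refine hS.eq_top _ fun a b ω ha hb => ?_
    by_contra hab
    simp only [LinearMap.mem_ker, Matrix.toLin'_apply] at hab
    obtain ⟨t, ht⟩ := hcon a b ((M *ᵥ a) ⬝ᵥ (M *ᵥ a) + (M *ᵥ b) ⬝ᵥ (M *ᵥ b)) (by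
      have h1 : 0 ≤ (M *ᵥ a) ⬝ᵥ (M *ᵥ a) := by simpa using dotProduct_star_self_nonneg (M *ᵥ a)
      have h2 : 0 ≤ (M *ᵥ b) ⬝ᵥ (M *ᵥ b) := by simpa using dotProduct_star_self_nonneg (M *ᵥ b)
      refine lt_of_le_of_ne (add_nonneg h1 h2) fun h => hab ?_
      exact ⟨dotProduct_self_eq_zero.1 (by linarith), dotProduct_self_eq_zero.1 (by linarith)⟩)
    apply ht
    rw [(exoState_of_eigenpair ha hb t).1, (exoState_of_eigenpair ha hb t).2]
    simp only [Matrix.mulVec_sub, Matrix.mulVec_add, Matrix.mulVec_smul, dotProduct_add,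
      dotProduct_sub, add_dotProduct, sub_dotProduct, smul_dotProduct, dotProduct_smul, smul_eq_mul]
    linear_combination ((M *ᵥ a) ⬝ᵥ (M *ᵥ a) + (M *ᵥ b) ⬝ᵥ (M *ᵥ b)) *
      Real.sin_sq_add_cos_sq (ω * t)
  apply hM
  rw [LinearMap.ker_eq_top] at hU
  exact (Matrix.toLin'.map_eq_zero_iff).1 hU

end Exponential
-- Decay of Hurwitz flows and the Lyapunov equation.
section Lyapunov

variable {n : ℕ}

/-- The scalar factors `exp(μ t) t^j / j!` of the solutions of a linear differential equation. -/
noncomputable def quasiMonomial (μ : ℂ) (j : ℕ) (t : ℝ) : ℂ :=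
  Complex.exp (μ * t) * ((t : ℂ) ^ j / (Nat.factorial j : ℂ))

theorem hasDerivAt_quasiMonomial_zero (μ : ℂ) (t : ℝ) :
    HasDerivAt (quasiMonomial μ 0) (μ * quasiMonomial μ 0 t) t := by
  have h : HasDerivAt (fun s : ℝ => Complex.exp (μ * s)) (Complex.exp (μ * t) * (μ * 1)) t :=
    (((hasDerivAt_id t).ofReal_comp).const_mul μ).cexp
  have h' : quasiMonomial μ 0 = fun s : ℝ => Complex.exp (μ * s) := by
    ext s; simp [quasiMonomial]
  rw [h']
  convert! h using 1
  ring

theorem hasDerivAt_quasiMonomial_succ (μ : ℂ) (j : ℕ) (t : ℝ) :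
    HasDerivAt (quasiMonomial μ (j + 1))
      (μ * quasiMonomial μ (j + 1) t + quasiMonomial μ j t) t := by
  have h : HasDerivAt (fun s : ℝ => Complex.exp (μ * s)) (Complex.exp (μ * t) * (μ * 1)) t :=
    (((hasDerivAt_id t).ofReal_comp).const_mul μ).cexp
  have h2 : HasDerivAt (fun s : ℝ => (s : ℂ) ^ (j + 1) / (Nat.factorial (j + 1) : ℂ))
      (((j + 1 : ℕ) : ℂ) * (t : ℂ) ^ j * 1 / (Nat.factorial (j + 1) : ℂ)) t :=
    (((hasDerivAt_id t).ofReal_comp).fun_pow (j + 1)).div_const _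
  convert! h.mul h2 using 1
  have hj : ((j : ℂ) + 1) ≠ 0 := by exact_mod_cast Nat.succ_ne_zero j
  have hf : (Nat.factorial j : ℂ) ≠ 0 := by exact_mod_cast Nat.factorial_ne_zero j
  simp only [quasiMonomial, Nat.factorial_succ]
  push_cast
  field_simp

theorem tendsto_quasiMonomial {μ : ℂ} (hμ : μ.re < 0) (j : ℕ) :
    Tendsto (quasiMonomial μ j) atTop (𝓝 0) := by
  rw [tendsto_zero_iff_norm_tendsto_zero]
  have h := (Real.tendsto_pow_mul_exp_neg_atTop_nhds_zero j).comp
    (tendsto_id.const_mul_atTop (neg_pos.2 hμ))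
  have h2 := h.const_mul ((1 / (-μ.re) ^ j) / (Nat.factorial j : ℝ))
  rw [mul_zero] at h2
  refine h2.congr' ?_
  filter_upwards [eventually_ge_atTop 0] with t ht
  have hm : (-μ.re) ^ j ≠ 0 := pow_ne_zero _ (neg_pos.2 hμ).ne'
  simp only [quasiMonomial, norm_mul, Complex.norm_exp, norm_div, norm_pow, Complex.norm_real,
    Real.norm_of_nonneg ht, Function.comp, id, Complex.norm_natCast]
  have : (μ * (t : ℂ)).re = -(-μ.re * t) := by simp
  rw [this, mul_pow]
  field_simp

/-- The initial states with decaying solution form a subspace, so it suffices to treat generalized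
eigenvectors, where the solution is a finite sum of terms exp(μt) tʲ/j! times Nʲv with N = E − μ. -/
theorem IsHurwitz.tendsto_exoState {F : Matrix (Fin n) (Fin n) ℝ} (hF : IsHurwitz F)
    (x₀ : Fin n → ℝ) : Tendsto (exoState F x₀) atTop (𝓝 0) := by
  let U : Submodule ℝ (Fin n → ℝ) :=
    { carrier := {v | Tendsto (exoState F v) atTop (𝓝 0)}
      zero_mem' := by
        have : exoState F (0 : Fin n → ℝ) = fun _ => 0 := by ext t; simp [exoState]
        change Tendsto (exoState F 0) atTop (𝓝 0)
        rw [this]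
        exact tendsto_const_nhds
      add_mem' := by
        intro v w hv hw
        have : exoState F (v + w) = fun t => exoState F v t + exoState F w t :=
          funext fun t => exoState_add F v w t
        change Tendsto (exoState F (v + w)) atTop (𝓝 0)
        rw [this]
        simpa using Tendsto.add hv hw
      smul_mem' := by
        intro r v hv
        have : exoState F (r • v) = fun t => r • exoState F v t :=
          funext fun t => exoState_smul F r v t
        change Tendsto (exoState F (r • v)) atTop (𝓝 0)
        rw [this]
        simpa using Tendsto.const_smul hv r }
  suffices hU : U = ⊤ by
    have : x₀ ∈ U := hU ▸ trivial
    exact this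
  refine eq_top_of_complexSpan_eq_top (eq_top_iff.2 ?_)
  set E := Matrix.toLin' (F.map (algebraMap ℝ ℂ)) with hE
  rw [← Module.End.iSup_maxGenEigenspace_eq_top E]
  refine iSup_le fun μ v hv => ?_
  by_cases hv0 : v = 0
  · rw [hv0]; exact Submodule.zero_mem _
  have hμ : μ.re < 0 := by
    refine hF μ ?_
    rw [← Matrix.spectrum_toLin', ← Module.End.hasEigenvalue_iff_mem_spectrum]
    refine Module.End.hasEigenvalue_of_hasGenEigenvalue (k := Module.finrank ℂ (Fin n → ℂ)) ?_
    intro h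
    rw [Module.End.maxGenEigenspace_eq_genEigenspace_finrank, h] at hv
    exact hv0 hv
  obtain ⟨k, hk⟩ := (Module.End.mem_maxGenEigenspace E μ v).1 hv
  set N := E - μ • (1 : Module.End ℂ (Fin n → ℂ)) with hN
  have hk' : (N ^ (k + 1)) v = 0 := by rw [pow_succ', Module.End.mul_apply, hk, map_zero]
  -- Using k + 1 terms, although Nᵏv is already zero, lets the sum be split both at j = 0 and at the
  -- vanishing top term, even when k = 0.
  let f : ℝ → Fin n → ℂ := fun t => ∑ j ∈ Finset.range (k + 1), quasiMonomial μ j t • (N ^ j) v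
  have hEf : ∀ t, E (f t) = μ • f t + ∑ j ∈ Finset.range k, quasiMonomial μ j t • (N ^ (j + 1)) v := by
    intro t
    have h1 : E (f t) = μ • f t + N (f t) := by simp [hN]
    rw [h1]
    congr 1
    simp only [f, map_sum, map_smul, ← Module.End.mul_apply, ← pow_succ']
    rw [Finset.sum_range_succ, hk', smul_zero, add_zero]
  have hf : ∀ t, HasDerivAt f (E (f t)) t := by
    intro t
    have h1 : HasDerivAt (fun t => ∑ j ∈ Finset.range k, quasiMonomial μ (j + 1) t • (N ^ (j + 1)) v +
        quasiMonomial μ 0 t • (N ^ 0) v)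
        (∑ j ∈ Finset.range k, (μ * quasiMonomial μ (j + 1) t + quasiMonomial μ j t) •
          (N ^ (j + 1)) v + (μ * quasiMonomial μ 0 t) • (N ^ 0) v) t := by
      refine HasDerivAt.add ?_ ((hasDerivAt_quasiMonomial_zero μ t).smul_const _)
      exact HasDerivAt.fun_sum fun j _ => (hasDerivAt_quasiMonomial_succ μ j t).smul_const _
    have h2 : f = fun t => ∑ j ∈ Finset.range k, quasiMonomial μ (j + 1) t • (N ^ (j + 1)) v +
        quasiMonomial μ 0 t • (N ^ 0) v := by
      ext1 t
      simp only [f]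
      rw [Finset.sum_range_succ']
    rw [hEf, congrFun h2 t]
    rw [h2]
    convert! h1 using 1
    simp only [smul_add, Finset.smul_sum, add_smul, Finset.sum_add_distrib, smul_smul]
    abel
  have hf0 : f 0 = v := by
    simp only [f]
    rw [Finset.sum_range_succ']
    simp [quasiMonomial]
  have hflim : Tendsto f atTop (𝓝 0) := by
    have : Tendsto f atTop (𝓝 (∑ j ∈ Finset.range (k + 1), (0 : ℂ) • (N ^ j) v)) :=
      tendsto_finsetSum _ fun j _ => (tendsto_quasiMonomial hμ j).smul_const _
    simpa using this
  have hEm : ∀ w, E w = F.map (algebraMap ℝ ℂ) *ᵥ w := fun w => by simp [hE]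
  have hre : ∀ t, HasDerivAt (fun t => reVec (f t)) (F *ᵥ reVec (f t)) t := by
    intro t
    rw [← reVec_mulVec, ← hEm]
    refine hasDerivAt_pi.2 fun i => ?_
    exact Complex.reCLM.hasFDerivAt.comp_hasDerivAt t (hasDerivAt_pi.1 (hf t) i)
  have him : ∀ t, HasDerivAt (fun t => imVec (f t)) (F *ᵥ imVec (f t)) t := by
    intro t
    rw [← imVec_mulVec, ← hEm]
    refine hasDerivAt_pi.2 fun i => ?_
    exact Complex.imCLM.hasFDerivAt.comp_hasDerivAt t (hasDerivAt_pi.1 (hf t) i)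
  constructor
  · change Tendsto (exoState F (reVec v)) atTop (𝓝 0)
    rw [← hf0, ← funext (eq_exoState_of_hasDerivAt hre), tendsto_pi_nhds]
    intro i
    exact (Complex.continuous_re.tendsto 0).comp ((tendsto_pi_nhds.1 hflim) i)
  · change Tendsto (exoState F (imVec v)) atTop (𝓝 0)
    rw [← hf0, ← funext (eq_exoState_of_hasDerivAt him), tendsto_pi_nhds]
    intro i
    exact (Complex.continuous_im.tendsto 0).comp ((tendsto_pi_nhds.1 hflim) i)

theorem hasDerivAt_dotProduct_mulVec {k l : ℕ} {x : ℝ → Fin k → ℝ} {y : ℝ → Fin l → ℝ}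
    {x' : Fin k → ℝ} {y' : Fin l → ℝ} {t : ℝ} (M : Matrix (Fin k) (Fin l) ℝ)
    (hx : HasDerivAt x x' t) (hy : HasDerivAt y y' t) :
    HasDerivAt (fun t => x t ⬝ᵥ (M *ᵥ y t)) (x' ⬝ᵥ (M *ᵥ y t) + x t ⬝ᵥ (M *ᵥ y')) t := by
  simp only [dotProduct, Matrix.mulVec, ← Finset.sum_add_distrib]
  refine HasDerivAt.fun_sum fun i _ => ?_
  refine (hasDerivAt_pi.1 hx i).mul ?_
  exact HasDerivAt.fun_sum fun j _ => (hasDerivAt_pi.1 hy j).const_mul _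

theorem tendsto_dotProduct_mulVec_exoState {F : Matrix (Fin n) (Fin n) ℝ} (hF : IsHurwitz F)
    (X : Matrix (Fin n) (Fin n) ℝ) (a b : Fin n → ℝ) :
    Tendsto (fun t => exoState F a t ⬝ᵥ (X *ᵥ exoState F b t)) atTop (𝓝 0) := by
  have hc : Continuous fun y : (Fin n → ℝ) × (Fin n → ℝ) => y.1 ⬝ᵥ (X *ᵥ y.2) := by fun_prop
  have h := (hc.tendsto (0, 0)).comp
    ((hF.tendsto_exoState a).prodMk_nhds (hF.tendsto_exoState b))
  simpa [Function.comp_def] using h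

/-- A Hurwitz matrix `F` has a positive definite solution of the Lyapunov equation
`Fᵀ X + X F = -1`. -/
theorem IsHurwitz.exists_lyapunov {F : Matrix (Fin n) (Fin n) ℝ} (hF : IsHurwitz F) :
    ∃ X : Matrix (Fin n) (Fin n) ℝ, X.PosDef ∧ Fᵀ * X + X * F = -1 := by
  let Φ : Matrix (Fin n) (Fin n) ℝ →ₗ[ℝ] Matrix (Fin n) (Fin n) ℝ :=
    { toFun := fun X => Fᵀ * X + X * F
      map_add' := fun X Y => by rw [mul_add, add_mul]; abel
      map_smul' := fun c X => by simp [smul_add] }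
  have hderiv : ∀ (X : Matrix (Fin n) (Fin n) ℝ) (a b : Fin n → ℝ) (t : ℝ),
      HasDerivAt (fun t => exoState F a t ⬝ᵥ (X *ᵥ exoState F b t))
        (exoState F a t ⬝ᵥ (Φ X *ᵥ exoState F b t)) t := by
    intro X a b t
    convert hasDerivAt_dotProduct_mulVec X (hasDerivAt_exoState F a t)
      (hasDerivAt_exoState F b t) using 1
    simp only [Φ, LinearMap.coe_mk, AddHom.coe_mk, Matrix.add_mulVec, dotProduct_add,
      ← Matrix.mulVec_mulVec]
    rw [Matrix.dotProduct_mulVec _ Fᵀ, Matrix.vecMul_transpose]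
  -- If Φ X = 0, the bilinear form of X is constant along pairs of solutions; since these decay, the
  -- constant is zero.
  have hinj : Function.Injective Φ := by
    rw [← LinearMap.ker_eq_bot, LinearMap.ker_eq_bot']
    intro X hX
    have hzero : ∀ a b, a ⬝ᵥ (X *ᵥ b) = 0 := by
      intro a b
      have hd : ∀ t, HasDerivAt (fun t => exoState F a t ⬝ᵥ (X *ᵥ exoState F b t)) 0 t := by
        intro t
        simpa [hX] using hderiv X a b t
      have hconst : ∀ t, exoState F a t ⬝ᵥ (X *ᵥ exoState F b t) = a ⬝ᵥ (X *ᵥ b) := by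
        intro t
        have := is_const_of_deriv_eq_zero (fun t => (hd t).differentiableAt)
          (fun t => (hd t).deriv) t 0
        simpa [exoState_zero] using this
      have h1 := tendsto_dotProduct_mulVec_exoState hF X a b
      simp only [hconst] at h1
      exact tendsto_nhds_unique tendsto_const_nhds h1
    ext i j
    simpa using hzero (Pi.single i 1) (Pi.single j 1)
  obtain ⟨X, hX⟩ := (LinearMap.injective_iff_surjective.1 hinj) (-1)
  -- The transpose solves the same equation, which has only one solution.
  have hsymm : Xᵀ = X := by
    apply hinj
    rw [hX]
    have := congrArg Matrix.transpose hX
    simp only [Φ, LinearMap.coe_mk, AddHom.coe_mk] at this ⊢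
    have h1 : (-1 : Matrix (Fin n) (Fin n) ℝ)ᵀ = -1 := by simp
    rw [h1] at this
    rw [← this]
    simp [add_comm]
  refine ⟨X, ?_, hX⟩
  rw [Matrix.posDef_iff_dotProduct_mulVec]
  refine ⟨by rw [Matrix.IsHermitian, Matrix.conjTranspose_eq_transpose_of_trivial, hsymm],
    fun a ha => ?_⟩
  have hd : ∀ t, HasDerivAt (fun t => exoState F a t ⬝ᵥ (X *ᵥ exoState F a t))
      (-(exoState F a t ⬝ᵥ exoState F a t)) t := by
    intro t
    simpa [hX, Matrix.neg_mulVec] using hderiv X a a t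
  have hsq : ∀ v : Fin n → ℝ, 0 ≤ v ⬝ᵥ v := fun v => by
    simpa using dotProduct_star_self_nonneg v
  have hanti : Antitone fun t => exoState F a t ⬝ᵥ (X *ᵥ exoState F a t) := by
    refine antitone_of_deriv_nonpos (fun t => (hd t).differentiableAt) fun t => ?_
    rw [(hd t).deriv]
    linarith [hsq (exoState F a t)]
  have hnonneg : ∀ t, 0 ≤ exoState F a t ⬝ᵥ (X *ᵥ exoState F a t) := fun t =>
    hanti.le_of_tendsto (tendsto_dotProduct_mulVec_exoState hF X a a) t
  have h0 : 0 ≤ a ⬝ᵥ (X *ᵥ a) := by simpa [exoState_zero] using hnonneg 0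
  simp only [star_trivial]
  refine lt_of_le_of_ne h0 fun h => ha ?_
  -- The flow is defined for negative times too. A zero of the form at t = 0 is thus an interior
  -- minimum, so the derivative −|a|² vanishes there.
  have hmax : IsMinOn (fun t => exoState F a t ⬝ᵥ (X *ᵥ exoState F a t)) Set.univ 0 := by
    intro t _
    simpa [exoState_zero, ← h] using hnonneg t
  have := (hmax.isLocalMin univ_mem).hasDerivAt_eq_zero (hd 0)
  rw [exoState_zero, neg_eq_zero] at this
  exact dotProduct_self_eq_zero.1 this

end Lyapunov
-- Elementary bounds for quadratic forms.
section QuadraticForms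

variable {k l : ℕ}

theorem dotProduct_self_nonneg_real (v : Fin k → ℝ) : 0 ≤ v ⬝ᵥ v := by
  simpa using dotProduct_star_self_nonneg v

theorem sq_dotProduct_le (v w : Fin k → ℝ) : (v ⬝ᵥ w) ^ 2 ≤ (v ⬝ᵥ v) * (w ⬝ᵥ w) := by
  have := Finset.sum_mul_sq_le_sq_mul_sq Finset.univ v w
  simpa [dotProduct, sq] using this

theorem exists_mulVec_sq_le (M : Matrix (Fin k) (Fin l) ℝ) :
    ∃ c, 0 ≤ c ∧ ∀ v, (M *ᵥ v) ⬝ᵥ (M *ᵥ v) ≤ c * (v ⬝ᵥ v) := by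
  -- The constant is the squared Frobenius norm of M.
  refine ⟨∑ i, M i ⬝ᵥ M i, Finset.sum_nonneg fun i _ => dotProduct_self_nonneg_real _,
    fun v => ?_⟩
  rw [Finset.sum_mul, dotProduct]
  refine Finset.sum_le_sum fun i _ => ?_
  have := sq_dotProduct_le (M i) v
  rw [sq] at this
  exact this

theorem exists_factor_of_posDef {X : Matrix (Fin k) (Fin k) ℝ} (hX : X.PosDef) :
    ∃ Y : Matrix (Fin k) (Fin k) ℝ, X = Yᵀ * Y := by
  open scoped MatrixOrder in
  obtain ⟨Y, hY⟩ := CStarAlgebra.nonneg_iff_eq_star_mul_self.mp hX.posSemidef.nonneg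
  refine ⟨Y, ?_⟩
  rw [hY, star_eq_conjTranspose, conjTranspose_eq_transpose_of_trivial]

theorem dotProduct_transpose_mul_mulVec (Y : Matrix (Fin k) (Fin l) ℝ) (v w : Fin l → ℝ) :
    v ⬝ᵥ ((Yᵀ * Y) *ᵥ w) = (Y *ᵥ v) ⬝ᵥ (Y *ᵥ w) := by
  rw [← Matrix.mulVec_mulVec, Matrix.dotProduct_mulVec _ Yᵀ, Matrix.vecMul_transpose]

theorem exists_le_of_posDef {X : Matrix (Fin k) (Fin k) ℝ} (hX : X.PosDef) :
    ∃ c, 0 < c ∧ ∀ v, v ⬝ᵥ v ≤ c * (v ⬝ᵥ (X *ᵥ v)) ∧ v ⬝ᵥ (X *ᵥ v) ≤ c * (v ⬝ᵥ v) := by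
  obtain ⟨Y, hY⟩ := exists_factor_of_posDef hX
  obtain ⟨c, hc, h1⟩ := exists_mulVec_sq_le Y
  -- Since X = YᵀY, the matrix X⁻¹Yᵀ is a left inverse of Y, so it bounds v in terms of Yv.
  obtain ⟨d, hd, h2⟩ := exists_mulVec_sq_le (X⁻¹ * Yᵀ)
  have hXY : ∀ v, v ⬝ᵥ (X *ᵥ v) = (Y *ᵥ v) ⬝ᵥ (Y *ᵥ v) := fun v => by
    rw [hY, dotProduct_transpose_mul_mulVec]
  refine ⟨c + d + 1, by positivity, fun v => ?_⟩
  have h3 := h2 (Y *ᵥ v)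
  have h4 : (X⁻¹ * Yᵀ) *ᵥ (Y *ᵥ v) = v := by
    rw [Matrix.mulVec_mulVec, Matrix.mul_assoc, ← hY,
      Matrix.nonsing_inv_mul _ ((Matrix.isUnit_iff_isUnit_det X).1 hX.isUnit), Matrix.one_mulVec]
  rw [h4] at h3
  rw [hXY]
  have h5 := h1 v
  have h6 := dotProduct_self_nonneg_real v
  have h7 := dotProduct_self_nonneg_real (Y *ᵥ v)
  constructor <;> nlinarith

theorem posDef_symm {X : Matrix (Fin k) (Fin k) ℝ} (hX : X.PosDef) : Xᵀ = X := by
  have := hX.isHermitian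
  rwa [Matrix.IsHermitian, Matrix.conjTranspose_eq_transpose_of_trivial] at this

theorem dotProduct_mulVec_comm_of_posDef {X : Matrix (Fin k) (Fin k) ℝ} (hX : X.PosDef)
    (v w : Fin k → ℝ) : v ⬝ᵥ (X *ᵥ w) = w ⬝ᵥ (X *ᵥ v) := by
  rw [Matrix.dotProduct_mulVec, ← Matrix.mulVec_transpose, posDef_symm hX, dotProduct_comm]

theorem posDef_nonneg {X : Matrix (Fin k) (Fin k) ℝ} (hX : X.PosDef) (v : Fin k → ℝ) :
    0 ≤ v ⬝ᵥ (X *ᵥ v) := by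
  simpa using hX.posSemidef.dotProduct_mulVec_nonneg v

theorem tendsto_zero_of_dotProduct_self {f : ℝ → Fin k → ℝ}
    (h : Tendsto (fun t => f t ⬝ᵥ f t) atTop (𝓝 0)) : Tendsto f atTop (𝓝 0) := by
  rw [tendsto_pi_nhds]
  intro i
  have h1 : Tendsto (fun t => Real.sqrt (f t ⬝ᵥ f t)) atTop (𝓝 0) := by
    simpa using h.sqrt
  refine squeeze_zero_norm (fun t => ?_) h1
  rw [Real.norm_eq_abs]
  refine Real.abs_le_sqrt ?_
  rw [sq]
  exact Finset.single_le_sum (f := fun i => f t i * f t i) (fun i _ => mul_self_nonneg _)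
    (Finset.mem_univ i)

end QuadraticForms

/-! ### Calculus of Carathéodory solutions. -/

section Primitives

/-- `f` is integrable on bounded subintervals of `[0, ∞)`. -/
def LocInt (f : ℝ → ℝ) : Prop := ∀ T : ℝ, 0 ≤ T → IntervalIntegrable f volume 0 T

/-- `x` is a primitive of the locally integrable function `f` on `[0, ∞)`. -/
structure IsPrimitive (x f : ℝ → ℝ) : Prop where
  locInt : LocInt f
  eq_integral : ∀ t, 0 ≤ t → x t = x 0 + ∫ s in (0 : ℝ)..t, f s

theorem LocInt.intervalIntegrable {f : ℝ → ℝ} (hf : LocInt f) {s t : ℝ} (hs : 0 ≤ s) (ht : 0 ≤ t) :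
    IntervalIntegrable f volume s t :=
  (hf s hs).symm.trans (hf t ht)

theorem LocInt.add {f g : ℝ → ℝ} (hf : LocInt f) (hg : LocInt g) : LocInt fun t => f t + g t :=
  fun T hT => (hf T hT).add (hg T hT)

theorem LocInt.sub {f g : ℝ → ℝ} (hf : LocInt f) (hg : LocInt g) : LocInt fun t => f t - g t :=
  fun T hT => (hf T hT).sub (hg T hT)

theorem LocInt.const_mul {f : ℝ → ℝ} (hf : LocInt f) (c : ℝ) : LocInt fun t => c * f t :=
  fun T hT => (hf T hT).const_mul c

theorem LocInt.sum {ι : Type*} {s : Finset ι} {f : ι → ℝ → ℝ} (hf : ∀ i ∈ s, LocInt (f i)) :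
    LocInt fun t => ∑ i ∈ s, f i t := fun T hT => by
  have := IntervalIntegrable.sum s (f := f) fun i hi => hf i hi T hT
  simpa [Finset.sum_fn] using this

theorem LocInt.mul_continuousOn {f g : ℝ → ℝ} (hf : LocInt f)
    (hg : ContinuousOn g (Set.Ici 0)) : LocInt fun t => f t * g t :=
  fun T hT => (hf T hT).mul_continuousOn (hg.mono fun x hx => by
    rw [Set.uIcc_of_le hT] at hx; exact hx.1)

theorem LocInt.of_continuousOn {f : ℝ → ℝ} (hf : ContinuousOn f (Set.Ici 0)) : LocInt f :=
  fun T hT => (hf.mono fun x hx => by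
    rw [Set.uIcc_of_le hT] at hx; exact hx.1).intervalIntegrable

theorem IsPrimitive.continuousOn {x f : ℝ → ℝ} (h : IsPrimitive x f) :
    ContinuousOn x (Set.Ici 0) := by
  intro t ht
  have ht' : (0 : ℝ) ≤ t := ht
  have h1 : ContinuousOn (fun t => x 0 + ∫ s in (0 : ℝ)..t, f s) (Set.uIcc 0 (t + 1)) :=
    continuousOn_const.add (intervalIntegral.continuousOn_primitive_interval'
      (h.locInt (t + 1) (by linarith)) Set.left_mem_uIcc)
  rw [Set.uIcc_of_le (by linarith)] at h1
  have h2 : ContinuousOn x (Set.Icc 0 (t + 1)) := h1.congr fun s hs => h.eq_integral s hs.1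
  refine (h2 t ⟨ht', by linarith⟩).mono_of_mem_nhdsWithin ?_
  rw [← Set.Ici_inter_Iic]
  exact Filter.inter_mem self_mem_nhdsWithin
    (mem_nhdsWithin_of_mem_nhds (Iic_mem_nhds (by linarith)))

theorem IsPrimitive.sub_eq {x f : ℝ → ℝ} (h : IsPrimitive x f) {s t : ℝ} (hs : 0 ≤ s)
    (ht : 0 ≤ t) : x t - x s = ∫ r in s..t, f r := by
  rw [h.eq_integral t ht, h.eq_integral s hs,
    ← intervalIntegral.integral_interval_sub_left (h.locInt t ht) (h.locInt s hs)]
  ring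

theorem IsPrimitive.const_mul {x f : ℝ → ℝ} (h : IsPrimitive x f) (c : ℝ) :
    IsPrimitive (fun t => c * x t) (fun t => c * f t) :=
  ⟨h.locInt.const_mul c, fun t ht => by
    rw [intervalIntegral.integral_const_mul, h.eq_integral t ht, mul_add]⟩

theorem IsPrimitive.sub {x y f g : ℝ → ℝ} (h : IsPrimitive x f) (h' : IsPrimitive y g) :
    IsPrimitive (fun t => x t - y t) (fun t => f t - g t) :=
  ⟨h.locInt.sub h'.locInt, fun t ht => by
    rw [intervalIntegral.integral_sub (h.locInt t ht) (h'.locInt t ht), h.eq_integral t ht,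
      h'.eq_integral t ht]
    ring⟩

theorem IsPrimitive.sum {ι : Type*} {s : Finset ι} {x f : ι → ℝ → ℝ}
    (h : ∀ i ∈ s, IsPrimitive (x i) (f i)) :
    IsPrimitive (fun t => ∑ i ∈ s, x i t) (fun t => ∑ i ∈ s, f i t) :=
  ⟨LocInt.sum fun i hi => (h i hi).locInt, fun t ht => by
    rw [intervalIntegral.integral_finsetSum fun i hi => (h i hi).locInt t ht,
      ← Finset.sum_add_distrib]
    exact Finset.sum_congr rfl fun i hi => (h i hi).eq_integral t ht⟩

theorem IsPrimitive.of_hasDerivAt {x f : ℝ → ℝ} (h : ∀ t, HasDerivAt x (f t) t)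
    (hf : Continuous f) : IsPrimitive x f :=
  ⟨fun _ _ => hf.intervalIntegrable _ _, fun t _ => by
    rw [intervalIntegral.integral_eq_sub_of_hasDerivAt (fun s _ => h s)
      (hf.intervalIntegrable _ _)]
    ring⟩

theorem IsPrimitive.ac {x f : ℝ → ℝ} (h : IsPrimitive x f) {T : ℝ} (hT : 0 ≤ T) :
    AbsolutelyContinuousOnInterval (fun t => x 0 + ∫ s in (0 : ℝ)..t, f s) 0 T := by
  have h1 := (h.locInt T hT).absolutelyContinuousOnInterval_intervalIntegral
    (c := 0) Set.left_mem_uIcc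
  have h2 : AbsolutelyContinuousOnInterval (fun _ : ℝ => x 0) 0 T :=
    (LipschitzWith.const (x 0)).lipschitzOnWith.absolutelyContinuousOnInterval
  exact h2.fun_add h1

/-- States driven by locally integrable controls are differentiable only almost everywhere, so the
product rule comes from integration by parts for absolutely continuous functions. -/
theorem IsPrimitive.mul {x y f g : ℝ → ℝ} (hx : IsPrimitive x f) (hy : IsPrimitive y g) :
    IsPrimitive (fun t => x t * y t) (fun t => f t * y t + x t * g t) := by
  refine ⟨(hx.locInt.mul_continuousOn hy.continuousOn).add ?_, fun T hT => ?_⟩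
  · simpa [mul_comm] using hy.locInt.mul_continuousOn hx.continuousOn
  have h1 := (hx.ac hT).integral_deriv_mul_eq_sub (hy.ac hT)
  rw [← hx.eq_integral T hT, ← hy.eq_integral T hT] at h1
  simp only [intervalIntegral.integral_same, add_zero] at h1
  rw [eq_comm, ← eq_sub_iff_add_eq', ← h1]
  refine intervalIntegral.integral_congr_ae ?_
  filter_upwards [(hx.locInt T hT).ae_hasDerivAt_integral,
    (hy.locInt T hT).ae_hasDerivAt_integral] with t hxt hyt ht
  have ht' : t ∈ Set.uIcc 0 T := Set.uIoc_subset_uIcc ht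
  have ht0 : 0 ≤ t := by rw [Set.uIcc_of_le hT] at ht'; exact ht'.1
  rw [((hxt ht' 0 Set.left_mem_uIcc).const_add (x 0)).deriv,
    ((hyt ht' 0 Set.left_mem_uIcc).const_add (y 0)).deriv, ← hx.eq_integral t ht0,
    ← hy.eq_integral t ht0]

/-- The vector function `x` is a coordinatewise primitive of `f` on `[0, ∞)`. -/
def IsVecPrimitive {k : ℕ} (x f : ℝ → Fin k → ℝ) : Prop :=
  ∀ i, IsPrimitive (fun t => x t i) (fun t => f t i)

variable {k l : ℕ}

theorem IsVecPrimitive.mulVec {x f : ℝ → Fin l → ℝ} (h : IsVecPrimitive x f)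
    (M : Matrix (Fin k) (Fin l) ℝ) :
    IsVecPrimitive (fun t => M *ᵥ x t) (fun t => M *ᵥ f t) :=
  fun i => IsPrimitive.sum (s := Finset.univ) fun j _ => (h j).const_mul (M i j)

theorem IsVecPrimitive.sub {x y f g : ℝ → Fin l → ℝ} (h : IsVecPrimitive x f)
    (h' : IsVecPrimitive y g) : IsVecPrimitive (fun t => x t - y t) (fun t => f t - g t) :=
  fun i => (h i).sub (h' i)

theorem IsVecPrimitive.dotProduct {x y f g : ℝ → Fin k → ℝ} (hx : IsVecPrimitive x f)
    (hy : IsVecPrimitive y g) :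
    IsPrimitive (fun t => x t ⬝ᵥ y t) (fun t => f t ⬝ᵥ y t + x t ⬝ᵥ g t) := by
  have := IsPrimitive.sum (s := Finset.univ) fun i _ => (hx i).mul (hy i)
  simpa [_root_.dotProduct, Finset.sum_add_distrib] using this

theorem isVecPrimitive_exoState (S : Matrix (Fin k) (Fin k) ℝ) (w₀ : Fin k → ℝ) :
    IsVecPrimitive (exoState S w₀) (fun t => S *ᵥ exoState S w₀ t) := fun i =>
  IsPrimitive.of_hasDerivAt (fun t => hasDerivAt_pi.1 (hasDerivAt_exoState S w₀ t) i)
    ((continuous_apply i).comp (continuous_const.matrix_mulVec (continuous_exoState S w₀)))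

variable {n m : ℕ}

theorem IsTrajectory.intervalIntegrable_rhs {A : Matrix (Fin n) (Fin n) ℝ}
    {B : Matrix (Fin n) (Fin m) ℝ} {x₀ : Fin n → ℝ} {u : ℝ → Fin m → ℝ} {x : ℝ → Fin n → ℝ}
    (h : IsTrajectory A B x₀ u x) {T : ℝ} (hT : 0 ≤ T) :
    IntervalIntegrable (fun s => A *ᵥ x s + B *ᵥ u s) volume 0 T := by
  refine IntervalIntegrable.add ?_ ?_
  · refine ContinuousOn.intervalIntegrable ?_
    have hc : Continuous fun v : Fin n → ℝ => A *ᵥ v := by fun_prop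
    exact hc.comp_continuousOn (h.state_continuous.mono fun t ht => by
      rw [Set.uIcc_of_le hT] at ht; exact ht.1)
  · have hu := h.control_integrable T hT
    let L := LinearMap.toContinuousLinearMap (Matrix.toLin' B)
    exact (⟨L.integrable_comp hu.1, L.integrable_comp hu.2⟩ :
      IntervalIntegrable (fun s => L (u s)) volume 0 T)

theorem IsTrajectory.isVecPrimitive {A : Matrix (Fin n) (Fin n) ℝ}
    {B : Matrix (Fin n) (Fin m) ℝ} {x₀ : Fin n → ℝ} {u : ℝ → Fin m → ℝ} {x : ℝ → Fin n → ℝ}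
    (h : IsTrajectory A B x₀ u x) :
    IsVecPrimitive x (fun t => A *ᵥ x t + B *ᵥ u t) := by
  intro i
  let pr := ContinuousLinearMap.proj (R := ℝ) (φ := fun _ : Fin n => ℝ) i
  refine ⟨fun T hT => ?_, fun t ht => ?_⟩
  · have hi := h.intervalIntegrable_rhs hT
    exact ⟨pr.integrable_comp hi.1, pr.integrable_comp hi.2⟩
  · have h0 : x 0 = x₀ := by simpa using h.state_eq 0 le_rfl
    have h1 := pr.intervalIntegral_comp_comm (h.intervalIntegrable_rhs ht)
    have h2 := congrFun (h.state_eq t ht) i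
    rw [h2, h0, Pi.add_apply]
    congr 1
    exact h1.symm

theorem IsTrajectory.of_hasDerivAt {A : Matrix (Fin n) (Fin n) ℝ}
    {B : Matrix (Fin n) (Fin m) ℝ} {u : ℝ → Fin m → ℝ} {x : ℝ → Fin n → ℝ}
    (hu : Continuous u) (hx : ∀ t, HasDerivAt x (A *ᵥ x t + B *ᵥ u t) t) :
    IsTrajectory A B (x 0) u x := by
  have hc : Continuous x := continuous_iff_continuousAt.2 fun t => (hx t).continuousAt
  refine ⟨fun T _ => hu.intervalIntegrable _ _, hc.continuousOn, fun t _ => ?_⟩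
  have hf : Continuous fun t => A *ᵥ x t + B *ᵥ u t :=
    (continuous_const.matrix_mulVec hc).add (continuous_const.matrix_mulVec hu)
  rw [intervalIntegral.integral_eq_sub_of_hasDerivAt (fun s _ => hx s)
    (hf.intervalIntegrable _ _)]
  abel

end Primitives
-- Dissipation and input-to-state estimates.
section StateEstimates

variable {n : ℕ}

theorem lyapunov_form_mulVec {F X : Matrix (Fin n) (Fin n) ℝ} (hFX : Fᵀ * X + X * F = -1)
    (v : Fin n → ℝ) : (F *ᵥ v) ⬝ᵥ (X *ᵥ v) + v ⬝ᵥ (X *ᵥ (F *ᵥ v)) = -(v ⬝ᵥ v) := by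
  have h := congrArg (fun M => v ⬝ᵥ (M *ᵥ v)) hFX
  simp only [Matrix.add_mulVec, dotProduct_add, ← Matrix.mulVec_mulVec, Matrix.neg_mulVec,
    Matrix.one_mulVec, dotProduct_neg] at h
  rw [Matrix.dotProduct_mulVec _ Fᵀ, Matrix.vecMul_transpose] at h
  exact h

/-- With X from the Lyapunov equation, the derivative of ξᵀXξ is −|ξ|² + 2ξᵀXd, and expanding |ξ −
2Xd|² ≥ 0 bounds this by −|ξ|²/2 + 2|Xd|². The majorant g replaces |d|², whose integrability is not
assumed. -/
theorem IsHurwitz.exists_dissipation {F : Matrix (Fin n) (Fin n) ℝ} (hF : IsHurwitz F) :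
    ∃ X : Matrix (Fin n) (Fin n) ℝ, X.PosDef ∧ ∃ c : ℝ, 0 ≤ c ∧
      ∀ (ξ d : ℝ → Fin n → ℝ) (g : ℝ → ℝ), IsVecPrimitive ξ (fun t => F *ᵥ ξ t + d t) →
        LocInt g → (∀ t, 0 ≤ t → d t ⬝ᵥ d t ≤ g t) → ∀ s t, 0 ≤ s → s ≤ t →
          ξ t ⬝ᵥ (X *ᵥ ξ t) + 1 / 2 * ∫ r in s..t, ξ r ⬝ᵥ ξ r ≤
            ξ s ⬝ᵥ (X *ᵥ ξ s) + c * ∫ r in s..t, g r := by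
  obtain ⟨X, hX, hFX⟩ := hF.exists_lyapunov
  obtain ⟨κ, hκ, hXd⟩ := exists_mulVec_sq_le X
  refine ⟨X, hX, 2 * κ, by positivity, fun ξ d g hξ hg hd s t hs hst => ?_⟩
  have hV := hξ.dotProduct (hξ.mulVec X)
  have hsq : LocInt fun t => ξ t ⬝ᵥ ξ t := LocInt.of_continuousOn (hξ.dotProduct hξ).continuousOn
  have ht : 0 ≤ t := hs.trans hst
  have h1 := hV.sub_eq hs ht
  have h2 : LocInt fun r => 2 * κ * g r - 1 / 2 * (ξ r ⬝ᵥ ξ r) :=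
    (hg.const_mul _).sub (hsq.const_mul _)
  have h3 := intervalIntegral.integral_mono_on hst (hV.locInt.intervalIntegrable hs ht)
    (h2.intervalIntegrable hs ht) fun r hr => by
      have e1 := lyapunov_form_mulVec hFX (ξ r)
      have e2 := dotProduct_mulVec_comm_of_posDef hX (d r) (ξ r)
      have e3 := dotProduct_self_nonneg_real (ξ r - (2 : ℝ) • (X *ᵥ d r))
      have e4 := hXd (d r)
      have e5 := mul_le_mul_of_nonneg_left (hd r (hs.trans hr.1)) hκ
      simp only [sub_dotProduct, dotProduct_sub, smul_dotProduct, dotProduct_smul, smul_eq_mul] at e3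
      rw [dotProduct_comm (X *ᵥ d r) (ξ r)] at e3
      simp only [Matrix.mulVec_add, add_dotProduct, dotProduct_add]
      linarith
  rw [intervalIntegral.integral_sub ((hg.const_mul _).intervalIntegrable hs ht)
    ((hsq.const_mul _).intervalIntegrable hs ht), intervalIntegral.integral_const_mul,
    intervalIntegral.integral_const_mul, ← h1] at h3
  linarith

/-- A nonnegative storage function which dissipates a supply of bounded total amount tends to
zero. -/
theorem tendsto_zero_of_dissipation {V W G : ℝ → ℝ} {c k M : ℝ} (hc : 0 < c) (hk : 0 ≤ k)
    (hV : ∀ t, 0 ≤ t → 0 ≤ V t) (hVW : ∀ t, 0 ≤ t → V t ≤ c * W t) (hW : LocInt W)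
    (hW0 : ∀ t, 0 ≤ t → 0 ≤ W t)
    (hG : ∀ s t, 0 ≤ s → s ≤ t → G s ≤ G t) (hGM : ∀ t, 0 ≤ t → G t ≤ M)
    (hdiss : ∀ s t, 0 ≤ s → s ≤ t → V t + 1 / 2 * ∫ r in s..t, W r ≤ V s + k * (G t - G s)) :
    Tendsto V atTop (𝓝 0) := by
  have hI : ∀ s t, 0 ≤ s → s ≤ t → 0 ≤ ∫ r in s..t, W r := fun s t hs hst =>
    intervalIntegral.integral_nonneg hst fun r hr => hW0 r (hs.trans hr.1)
  obtain ⟨g, hg⟩ : ∃ g, Tendsto G atTop (𝓝 g) := by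
    have hm : Monotone fun t => G (max t 0) := fun s t hst =>
      hG _ _ (le_max_right _ _) (max_le_max hst le_rfl)
    have hb : BddAbove (Set.range fun t => G (max t 0)) := by
      refine ⟨M, ?_⟩
      rintro _ ⟨t, rfl⟩
      exact hGM _ (le_max_right _ _)
    refine ⟨_, (tendsto_atTop_ciSup hm hb).congr' ?_⟩
    filter_upwards [eventually_ge_atTop 0] with t ht
    rw [max_eq_left ht]
  -- By dissipation V − kG is nonincreasing and bounded below on [0, ∞); as G converges too, V has a
  -- limit. `max t 0` extends the monotonicity to the whole line.
  obtain ⟨e, he⟩ : ∃ e, Tendsto (fun t => V t - k * G t) atTop (𝓝 e) := by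
    have hm : Antitone fun t => V (max t 0) - k * G (max t 0) := fun s t hst => by
      have h0 : max s 0 ≤ max t 0 := max_le_max hst le_rfl
      have h1 := hdiss _ _ (le_max_right s 0) h0
      have h2 := hI _ _ (le_max_right s 0) h0
      simp only
      linarith
    have hb : BddBelow (Set.range fun t => V (max t 0) - k * G (max t 0)) := by
      refine ⟨-(k * M), ?_⟩
      rintro _ ⟨t, rfl⟩
      have h1 := hV _ (le_max_right t 0)
      have h2 := mul_le_mul_of_nonneg_left (hGM _ (le_max_right t 0)) hk
      simp only
      linarith
    refine ⟨_, (tendsto_atTop_ciInf hm hb).congr' ?_⟩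
    filter_upwards [eventually_ge_atTop 0] with t ht
    rw [max_eq_left ht]
  have hlim : Tendsto V atTop (𝓝 (e + k * g)) := by
    refine (he.add (hg.const_mul k)).congr fun t => ?_
    ring
  set ℓ := e + k * g
  have hℓ : 0 ≤ ℓ := ge_of_tendsto hlim (by
    filter_upwards [eventually_ge_atTop 0] with t ht using hV t ht)
  rcases hℓ.eq_or_lt with h | h
  · rwa [← h] at hlim
  exfalso
  obtain ⟨T, hT⟩ := eventually_atTop.1 (hlim.eventually (lt_mem_nhds (half_lt_self h)))
  set s := max T 0
  have hs : 0 ≤ s := le_max_right _ _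
  -- If the limit ℓ of V were positive, W would stay above ℓ/(2c) and its integral would grow
  -- linearly, against the bounded supply.
  have hbig : ∀ t, s ≤ t → (t - s) * (ℓ / 2 / c) ≤ 2 * (V s + k * (M - G s)) := by
    intro t hst
    have ht := hs.trans hst
    have h1 : ∫ _ in s..t, (ℓ / 2 / c) ≤ ∫ r in s..t, W r := by
      refine intervalIntegral.integral_mono_on hst intervalIntegrable_const
        (hW.intervalIntegrable hs ht) fun r hr => ?_
      rw [div_le_iff₀ hc, mul_comm]
      exact (hT r ((le_max_left _ _).trans hr.1)).le.trans (hVW r (hs.trans hr.1))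
    rw [intervalIntegral.integral_const, smul_eq_mul] at h1
    have h2 := hdiss s t hs hst
    have h3 := mul_le_mul_of_nonneg_left (hGM t ht) hk
    have h4 := hV t ht
    linarith
  have hpos : 0 < ℓ / 2 / c := by positivity
  set Z := 2 * (V s + k * (M - G s))
  -- Evaluation at t = s gives Z ≥ 0, which makes the next time admissible; there the bound reads Z
  -- + 1 ≤ Z.
  have h5 := hbig s le_rfl
  rw [sub_self, zero_mul] at h5
  have h6 := hbig (s + (Z + 1) / (ℓ / 2 / c)) (by
    have : 0 ≤ (Z + 1) / (ℓ / 2 / c) := by positivity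
    linarith)
  rw [add_sub_cancel_left, div_mul_cancel₀ _ hpos.ne'] at h6
  linarith

/-- Input-to-state estimates for a Hurwitz system driven by a square integrable input. -/
theorem IsHurwitz.exists_state_bound {F : Matrix (Fin n) (Fin n) ℝ} (hF : IsHurwitz F) :
    ∃ c : ℝ, 0 < c ∧
      ∀ (ξ d : ℝ → Fin n → ℝ) (g : ℝ → ℝ), IsVecPrimitive ξ (fun t => F *ᵥ ξ t + d t) →
        LocInt g → (∀ t, 0 ≤ t → d t ⬝ᵥ d t ≤ g t) →
          (∀ t, 0 ≤ t → ξ t ⬝ᵥ ξ t ≤ c * (ξ 0 ⬝ᵥ ξ 0 + ∫ r in (0 : ℝ)..t, g r)) ∧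
          (∀ t, 0 ≤ t →
            ∫ r in (0 : ℝ)..t, ξ r ⬝ᵥ ξ r ≤ c * (ξ 0 ⬝ᵥ ξ 0 + ∫ r in (0 : ℝ)..t, g r)) ∧
          ((∃ M, ∀ t, 0 ≤ t → ∫ r in (0 : ℝ)..t, g r ≤ M) → Tendsto ξ atTop (𝓝 0)) := by
  obtain ⟨X, hX, k, hk, hdiss⟩ := hF.exists_dissipation
  obtain ⟨b, hb, hXb⟩ := exists_le_of_posDef hX
  -- The pointwise bound needs the factor b (from X to the Euclidean norm), the integral bound the
  -- factor 2 (from the ½ in the dissipation inequality); b + 2 serves both.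
  refine ⟨(b + 2) * (b + k), by positivity, fun ξ d g hξ hg hd => ?_⟩
  have hsq : LocInt fun t => ξ t ⬝ᵥ ξ t := LocInt.of_continuousOn (hξ.dotProduct hξ).continuousOn
  have hg0 : ∀ t, 0 ≤ t → 0 ≤ g t := fun t ht => (dotProduct_self_nonneg_real _).trans (hd t ht)
  have hd' := hdiss ξ d g hξ hg hd
  have hI : ∀ t, 0 ≤ t → 0 ≤ ∫ r in (0 : ℝ)..t, ξ r ⬝ᵥ ξ r := fun t ht =>
    intervalIntegral.integral_nonneg ht fun r _ => dotProduct_self_nonneg_real _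
  have hIg : ∀ t, 0 ≤ t → 0 ≤ ∫ r in (0 : ℝ)..t, g r := fun t ht =>
    intervalIntegral.integral_nonneg ht fun r hr => hg0 r hr.1
  have hrhs : ∀ t, 0 ≤ t → ξ 0 ⬝ᵥ (X *ᵥ ξ 0) + k * ∫ r in (0 : ℝ)..t, g r ≤
      (b + k) * (ξ 0 ⬝ᵥ ξ 0 + ∫ r in (0 : ℝ)..t, g r) := fun t ht => by
    have h1 := (hXb (ξ 0)).2
    have h2 := mul_nonneg hb.le (hIg t ht)
    have h3 := mul_nonneg hk (dotProduct_self_nonneg_real (ξ 0))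
    linarith
  have hrn : ∀ t, 0 ≤ t → 0 ≤ (b + k) * (ξ 0 ⬝ᵥ ξ 0 + ∫ r in (0 : ℝ)..t, g r) := fun t ht =>
    mul_nonneg (by positivity) (add_nonneg (dotProduct_self_nonneg_real _) (hIg t ht))
  refine ⟨fun t ht => ?_, fun t ht => ?_, ?_⟩
  · have h1 := hd' 0 t le_rfl ht
    have h2 := (hXb (ξ t)).1
    have h3 := hI t ht
    have h4 : ξ t ⬝ᵥ (X *ᵥ ξ t) ≤ (b + k) * (ξ 0 ⬝ᵥ ξ 0 + ∫ r in (0 : ℝ)..t, g r) := by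
      linarith [hrhs t ht]
    have h5 := mul_le_mul_of_nonneg_left h4 hb.le
    linarith [hrn t ht]
  · have h1 := hd' 0 t le_rfl ht
    have h2 := posDef_nonneg hX (ξ t)
    have h4 : ∫ r in (0 : ℝ)..t, ξ r ⬝ᵥ ξ r ≤
        2 * ((b + k) * (ξ 0 ⬝ᵥ ξ 0 + ∫ r in (0 : ℝ)..t, g r)) := by
      linarith [hrhs t ht]
    have h5 := mul_nonneg hb.le (hrn t ht)
    linarith [hrn t ht]
  · rintro ⟨M, hM⟩
    have hV : Tendsto (fun t => ξ t ⬝ᵥ (X *ᵥ ξ t)) atTop (𝓝 0) := by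
      refine tendsto_zero_of_dissipation (W := fun t => ξ t ⬝ᵥ ξ t)
        (G := fun t => ∫ r in (0 : ℝ)..t, g r) hb hk (fun t _ => posDef_nonneg hX _)
        (fun t _ => (hXb (ξ t)).2) hsq (fun t _ => dotProduct_self_nonneg_real _)
        (fun s t hs hst => ?_) hM (fun s t hs hst => ?_)
      · rw [← sub_nonneg, intervalIntegral.integral_interval_sub_left (hg t (hs.trans hst))
          (hg s hs)]
        exact intervalIntegral.integral_nonneg hst fun r hr => hg0 r (hs.trans hr.1)
      · rw [intervalIntegral.integral_interval_sub_left (hg t (hs.trans hst)) (hg s hs)]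
        exact hd' s t hs hst
    refine tendsto_zero_of_dotProduct_self ?_
    have h1 := hV.const_mul b
    rw [mul_zero] at h1
    exact squeeze_zero (fun t => dotProduct_self_nonneg_real _) (fun t => (hXb (ξ t)).1) h1

end StateEstimates

/-! ### Unique solvability of the Hamiltonian Sylvester equation. -/

section HamiltonianSylvester

variable {n m p q : ℕ}

theorem IsHurwitz.transpose {F : Matrix (Fin n) (Fin n) ℝ} (hF : IsHurwitz F) :
    IsHurwitz Fᵀ := by
  intro μ hμ
  refine hF μ ?_
  rw [spectrum.mem_iff] at hμ ⊢
  intro h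
  apply hμ
  have h1 : algebraMap ℂ (Matrix (Fin n) (Fin n) ℂ) μ - Fᵀ.map (algebraMap ℝ ℂ) =
      (algebraMap ℂ (Matrix (Fin n) (Fin n) ℂ) μ - F.map (algebraMap ℝ ℂ))ᵀ := by
    rw [Matrix.transpose_sub, Matrix.algebraMap_eq_diagonal, Matrix.diagonal_transpose,
      Matrix.transpose_map]
  rw [h1, Matrix.isUnit_transpose]
  exact h

/-- A Hurwitz matrix has no purely imaginary eigenvalue. -/
theorem IsHurwitz.eq_zero_of_eigenpair {F : Matrix (Fin n) (Fin n) ℝ} (hF : IsHurwitz F)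
    {x y : Fin n → ℝ} {ω : ℝ} (hx : F *ᵥ x = -(ω • y)) (hy : F *ᵥ y = ω • x) :
    x = 0 ∧ y = 0 := by
  -- On x and y the left sides of the Lyapunov identity are opposite, so adding them leaves |x|² +
  -- |y|² = 0.
  obtain ⟨X, hX, hFX⟩ := hF.exists_lyapunov
  have h1 := lyapunov_form_mulVec hFX x
  have h2 := lyapunov_form_mulVec hFX y
  have h3 := dotProduct_mulVec_comm_of_posDef hX x y
  simp only [hx, hy, Matrix.mulVec_neg, Matrix.mulVec_smul, neg_dotProduct, dotProduct_neg,
    smul_dotProduct, dotProduct_smul, smul_eq_mul] at h1 h2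
  rw [h3] at h1
  rw [h3] at h2
  have h4 := dotProduct_self_nonneg_real x
  have h5 := dotProduct_self_nonneg_real y
  exact ⟨dotProduct_self_eq_zero.1 (by linarith), dotProduct_self_eq_zero.1 (by linarith)⟩

theorem IsHurwitz.isUnit {F : Matrix (Fin n) (Fin n) ℝ} (hF : IsHurwitz F) : IsUnit F := by
  rw [← Matrix.mulVec_injective_iff_isUnit, ← Matrix.coe_mulVecLin, ← LinearMap.ker_eq_bot,
    LinearMap.ker_eq_bot']
  intro v hv
  rw [Matrix.mulVecLin_apply] at hv
  exact (hF.eq_zero_of_eigenpair (x := v) (y := 0) (ω := 0) (by simp [hv]) (by simp)).1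

theorem eq_zero_of_posDef {k : ℕ} {X : Matrix (Fin k) (Fin k) ℝ} (hX : X.PosDef) {v : Fin k → ℝ}
    (h : v ⬝ᵥ (X *ᵥ v) = 0) : v = 0 := by
  by_contra hv
  have := hX.dotProduct_mulVec_pos hv
  simp [h] at this

variable {A : Matrix (Fin n) (Fin n) ℝ} {B : Matrix (Fin n) (Fin m) ℝ}
  {C : Matrix (Fin p) (Fin n) ℝ} {Q : Matrix (Fin p) (Fin p) ℝ} {R : Matrix (Fin m) (Fin m) ℝ}
  {S : Matrix (Fin q) (Fin q) ℝ}

/-- The Hamiltonian matrix of a stabilizable and detectable system with definite weights has no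
purely imaginary eigenvalue. -/
theorem hamiltonian_eigenpair_eq_zero (hQ : Q.PosDef) (hR : R.PosDef)
    (hstab : IsStabilizable A B) (hdet : IsDetectable A C)
    {x y l k : Fin n → ℝ} {ω : ℝ}
    (hx : A *ᵥ x - (B * R⁻¹ * Bᵀ) *ᵥ l = -(ω • y))
    (hy : A *ᵥ y - (B * R⁻¹ * Bᵀ) *ᵥ k = ω • x)
    (hl : -((Cᵀ * Q * C) *ᵥ x) - Aᵀ *ᵥ l = -(ω • k))
    (hk : -((Cᵀ * Q * C) *ᵥ y) - Aᵀ *ᵥ k = ω • l) :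
    x = 0 ∧ y = 0 ∧ l = 0 ∧ k = 0 := by
  have hW : ∀ v w : Fin n → ℝ,
      v ⬝ᵥ ((B * R⁻¹ * Bᵀ) *ᵥ w) = (Bᵀ *ᵥ v) ⬝ᵥ (R⁻¹ *ᵥ (Bᵀ *ᵥ w)) := fun v w => by
    rw [← Matrix.mulVec_mulVec, ← Matrix.mulVec_mulVec, Matrix.dotProduct_mulVec _ B,
      Matrix.mulVec_transpose B v]
  have hH : ∀ v w : Fin n → ℝ,
      v ⬝ᵥ ((Cᵀ * Q * C) *ᵥ w) = (C *ᵥ v) ⬝ᵥ (Q *ᵥ (C *ᵥ w)) := fun v w => by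
    rw [← Matrix.mulVec_mulVec, ← Matrix.mulVec_mulVec, Matrix.dotProduct_mulVec _ Cᵀ,
      Matrix.vecMul_transpose]
  have hA : ∀ v w : Fin n → ℝ, v ⬝ᵥ (Aᵀ *ᵥ w) = w ⬝ᵥ (A *ᵥ v) := fun v w => by
    rw [Matrix.dotProduct_mulVec, Matrix.vecMul_transpose, dotProduct_comm]
  -- Pair the state equations with the costates and the costate equations with the states. In the
  -- sum all A-terms and ω-terms cancel, leaving four nonnegative forms with sum zero.
  have e1 := congrArg (fun v => l ⬝ᵥ v) hx
  have e2 := congrArg (fun v => k ⬝ᵥ v) hy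
  have e3 := congrArg (fun v => x ⬝ᵥ v) hl
  have e4 := congrArg (fun v => y ⬝ᵥ v) hk
  simp only [dotProduct_sub, dotProduct_neg, dotProduct_smul, smul_eq_mul, hW, hH, hA]
    at e1 e2 e3 e4
  rw [dotProduct_comm x k] at e3
  rw [dotProduct_comm y l] at e4
  have p1 := posDef_nonneg hQ (C *ᵥ x)
  have p2 := posDef_nonneg hQ (C *ᵥ y)
  have p3 := posDef_nonneg hR.inv (Bᵀ *ᵥ l)
  have p4 := posDef_nonneg hR.inv (Bᵀ *ᵥ k)
  have z1 : C *ᵥ x = 0 := eq_zero_of_posDef hQ (by linarith)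
  have z2 : C *ᵥ y = 0 := eq_zero_of_posDef hQ (by linarith)
  have z3 : Bᵀ *ᵥ l = 0 := eq_zero_of_posDef hR.inv (by linarith)
  have z4 : Bᵀ *ᵥ k = 0 := eq_zero_of_posDef hR.inv (by linarith)
  simp only [← Matrix.mulVec_mulVec, z1, z2, z3, z4, Matrix.mulVec_zero, sub_zero, neg_zero,
    zero_sub] at hx hy hl hk
  obtain ⟨L, hL⟩ := hdet
  obtain ⟨F, hF⟩ := hstab
  -- Now x + iy is an eigenvector of A + LC unless zero, and likewise l + ik for (A + BF)ᵀ, with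
  -- imaginary eigenvalues.
  have h1 := hL.eq_zero_of_eigenpair (x := x) (y := y) (ω := ω)
    (by rw [Matrix.add_mulVec, ← Matrix.mulVec_mulVec, z1, Matrix.mulVec_zero, add_zero, hx])
    (by rw [Matrix.add_mulVec, ← Matrix.mulVec_mulVec, z2, Matrix.mulVec_zero, add_zero, hy])
  have h2 := hF.transpose.eq_zero_of_eigenpair (x := l) (y := k) (ω := -ω)
    (by
      rw [Matrix.transpose_add, Matrix.transpose_mul, Matrix.add_mulVec, ← Matrix.mulVec_mulVec,
        z3, Matrix.mulVec_zero, add_zero, neg_smul, neg_neg]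
      exact neg_injective hl)
    (by
      rw [Matrix.transpose_add, Matrix.transpose_mul, Matrix.add_mulVec, ← Matrix.mulVec_mulVec,
        z4, Matrix.mulVec_zero, add_zero, neg_smul, ← hk, neg_neg])
  exact ⟨h1.1, h1.2, h2.1, h2.2⟩

/-- The Hamiltonian Sylvester equation in its two block rows. -/
theorem solvesHamiltonianSylvester_iff {D : Matrix (Fin p) (Fin q) ℝ}
    {P L : Matrix (Fin n) (Fin q) ℝ} {G : Matrix (Fin m) (Fin q) ℝ} :
    SolvesHamiltonianSylvester A B C Q R S D P L G ↔
      (P * S = A * P - B * R⁻¹ * Bᵀ * L ∧ L * S = -(Cᵀ * Q * C * P) - Aᵀ * L + Cᵀ * Q * D) ∧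
        G = -(R⁻¹ * Bᵀ * L) := by
  have h1 : Matrix.fromRows P L * S = Matrix.fromRows (P * S) (L * S) :=
    Matrix.fromRows_mul _ _ _
  have h2 : hamiltonian A B C Q R * Matrix.fromRows P L + Matrix.fromRows 0 (Cᵀ * Q * D) =
      Matrix.fromRows (A * P - B * R⁻¹ * Bᵀ * L)
        (-(Cᵀ * Q * C * P) - Aᵀ * L + Cᵀ * Q * D) := by
    rw [hamiltonian, Matrix.fromBlocks_mul_fromRows]
    ext (i | i) j <;> simp [sub_eq_add_neg]
  rw [SolvesHamiltonianSylvester, h1, h2, Matrix.fromRows_inj.eq_iff]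

theorem existsUnique_solvesHamiltonianSylvester (hQ : Q.PosDef) (hR : R.PosDef)
    (hstab : IsStabilizable A B) (hdet : IsDetectable A C)
    (hS : HasSemisimpleImaginarySpectrum S) (D : Matrix (Fin p) (Fin q) ℝ) :
    ∃! X : Matrix (Fin n) (Fin q) ℝ × Matrix (Fin n) (Fin q) ℝ × Matrix (Fin m) (Fin q) ℝ,
      SolvesHamiltonianSylvester A B C Q R S D X.1 X.2.1 X.2.2 := by
  let Φ : (Matrix (Fin n) (Fin q) ℝ × Matrix (Fin n) (Fin q) ℝ) →ₗ[ℝ]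
      (Matrix (Fin n) (Fin q) ℝ × Matrix (Fin n) (Fin q) ℝ) :=
    { toFun := fun X => (X.1 * S - (A * X.1 - B * R⁻¹ * Bᵀ * X.2),
        X.2 * S - (-(Cᵀ * Q * C * X.1) - Aᵀ * X.2))
      map_add' := fun X Y => by
        ext1 <;> simp only [Prod.fst_add, Prod.snd_add, Matrix.add_mul, Matrix.mul_add] <;> abel
      map_smul' := fun c X => by
        ext1 <;> simp only [Prod.smul_fst, Prod.smul_snd, Matrix.smul_mul, Matrix.mul_smul,
          smul_sub, smul_neg, RingHom.id_apply] }
  have hinj : Function.Injective Φ := by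
    rw [← LinearMap.ker_eq_bot, LinearMap.ker_eq_bot']
    rintro ⟨P, L⟩ hPL
    have hP : P * S = A * P - B * R⁻¹ * Bᵀ * L := sub_eq_zero.1 (congrArg Prod.fst hPL)
    have hL : L * S = -(Cᵀ * Q * C * P) - Aᵀ * L := sub_eq_zero.1 (congrArg Prod.snd hPL)
    have hP' : ∀ v, A *ᵥ (P *ᵥ v) - (B * R⁻¹ * Bᵀ) *ᵥ (L *ᵥ v) = P *ᵥ (S *ᵥ v) := fun v => by
      rw [Matrix.mulVec_mulVec, Matrix.mulVec_mulVec, Matrix.mulVec_mulVec, hP, Matrix.sub_mulVec]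
    have hL' : ∀ v, -((Cᵀ * Q * C) *ᵥ (P *ᵥ v)) - Aᵀ *ᵥ (L *ᵥ v) = L *ᵥ (S *ᵥ v) := fun v => by
      rw [Matrix.mulVec_mulVec, Matrix.mulVec_mulVec, Matrix.mulVec_mulVec, hL, Matrix.sub_mulVec,
        Matrix.neg_mulVec]
    -- A solution (P, L) of the homogeneous equation intertwines S with the Hamiltonian matrix, so
    -- it maps eigenpairs of S to eigenpairs of the latter, which are zero.
    have hU : LinearMap.ker (Matrix.toLin' P) ⊓ LinearMap.ker (Matrix.toLin' L) = ⊤ := by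
      refine hS.eq_top _ fun a b ω ha hb => ?_
      obtain ⟨h1, h2, h3, h4⟩ := hamiltonian_eigenpair_eq_zero (x := P *ᵥ a) (y := P *ᵥ b)
        (l := L *ᵥ a) (k := L *ᵥ b) (ω := ω) hQ hR hstab hdet
        (by rw [hP', ha, Matrix.mulVec_neg, Matrix.mulVec_smul])
        (by rw [hP', hb, Matrix.mulVec_smul])
        (by rw [hL', ha, Matrix.mulVec_neg, Matrix.mulVec_smul])
        (by rw [hL', hb, Matrix.mulVec_smul])
      simp [Submodule.mem_inf, LinearMap.mem_ker, Matrix.toLin'_apply, h1, h2, h3, h4]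
    obtain ⟨hU1, hU2⟩ := inf_eq_top_iff.1 hU
    rw [LinearMap.ker_eq_top] at hU1 hU2
    exact Prod.ext ((Matrix.toLin'.map_eq_zero_iff).1 hU1) ((Matrix.toLin'.map_eq_zero_iff).1 hU2)
  have hiff : ∀ (P L : Matrix (Fin n) (Fin q) ℝ) (G : Matrix (Fin m) (Fin q) ℝ),
      SolvesHamiltonianSylvester A B C Q R S D P L G ↔
        Φ (P, L) = (0, Cᵀ * Q * D) ∧ G = -(R⁻¹ * Bᵀ * L) := fun P L G => by
    rw [solvesHamiltonianSylvester_iff, Prod.ext_iff]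
    simp only [Φ, LinearMap.coe_mk, AddHom.coe_mk]
    rw [sub_eq_zero, sub_eq_iff_eq_add']
  obtain ⟨⟨P, L⟩, hPL⟩ := (LinearMap.injective_iff_surjective.1 hinj) (0, Cᵀ * Q * D)
  refine ⟨(P, L, -(R⁻¹ * Bᵀ * L)), (hiff _ _ _).2 ⟨hPL, rfl⟩, ?_⟩
  rintro ⟨P', L', G'⟩ h'
  obtain ⟨h1, h2⟩ := (hiff _ _ _).1 h'
  obtain ⟨rfl, rfl⟩ := Prod.ext_iff.1 (hinj (h1.trans hPL.symm))
  exact Prod.ext rfl (Prod.ext rfl h2)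

end HamiltonianSylvester
-- The cost as deviation cost, boundary term and stationary cost.
section CostIdentity

variable {n m p q : ℕ}

/-- The integrand `eᵀ Q e + uᵀ R u` of the cost. -/
def stageCost (Q : Matrix (Fin p) (Fin p) ℝ) (R : Matrix (Fin m) (Fin m) ℝ)
    (e : ℝ → Fin p → ℝ) (u : ℝ → Fin m → ℝ) (t : ℝ) : ℝ :=
  e t ⬝ᵥ (Q *ᵥ e t) + u t ⬝ᵥ (R *ᵥ u t)

variable {A : Matrix (Fin n) (Fin n) ℝ} {B : Matrix (Fin n) (Fin m) ℝ}
  {C : Matrix (Fin p) (Fin n) ℝ} {Q : Matrix (Fin p) (Fin p) ℝ} {R : Matrix (Fin m) (Fin m) ℝ}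
  {S : Matrix (Fin q) (Fin q) ℝ} {D : Matrix (Fin p) (Fin q) ℝ}
  {P L : Matrix (Fin n) (Fin q) ℝ} {G : Matrix (Fin m) (Fin q) ℝ}

theorem stageCost_nonneg (hQ : Q.PosDef) (hR : R.PosDef) (e : ℝ → Fin p → ℝ)
    (u : ℝ → Fin m → ℝ) (t : ℝ) : 0 ≤ stageCost Q R e u t :=
  add_nonneg (posDef_nonneg hQ _) (posDef_nonneg hR _)

theorem cost_eq (hQ : Q.PosDef) (hR : R.PosDef) {e : ℝ → Fin p → ℝ} {u : ℝ → Fin m → ℝ} {T : ℝ}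
    (hT : 0 ≤ T) (h : IntervalIntegrable (stageCost Q R e u) volume 0 T) :
    ((cost Q R T e u : ENNReal) : EReal) =
      ((1 / 2 * ∫ t in (0 : ℝ)..T, stageCost Q R e u t : ℝ) : EReal) := by
  have h1 : 0 ≤ ∫ t in (0 : ℝ)..T, stageCost Q R e u t :=
    intervalIntegral.integral_nonneg hT fun t _ => stageCost_nonneg hQ hR e u t
  have h2 : cost Q R T e u =
      ENNReal.ofReal (1 / 2 * ∫ t in (0 : ℝ)..T, stageCost Q R e u t) := by
    rw [ENNReal.ofReal_mul (by norm_num), intervalIntegral.integral_of_le hT,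
      ← integral_Icc_eq_integral_Ioc, ofReal_integral_eq_lintegral_ofReal]
    · rw [cost]
      congr 1
      rw [ENNReal.ofReal_div_of_pos two_pos]
      simp
    · rwa [intervalIntegrable_iff_integrableOn_Icc_of_le hT] at h
    · exact Eventually.of_forall fun t => stageCost_nonneg hQ hR e u t
  rw [h2, EReal.coe_ennreal_ofReal, max_eq_left (by positivity)]

theorem cost_eq_top (hQ : Q.PosDef) (hR : R.PosDef) {e : ℝ → Fin p → ℝ} {u : ℝ → Fin m → ℝ} {T : ℝ}
    (hT : 0 ≤ T) (he : ContinuousOn e (Set.Ici 0)) (hu : IntervalIntegrable u volume 0 T)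
    (h : ¬ IntervalIntegrable (stageCost Q R e u) volume 0 T) : cost Q R T e u = ⊤ := by
  rw [intervalIntegrable_iff_integrableOn_Icc_of_le hT] at h hu
  -- Measurability is what makes nonintegrability of the nonnegative integrand mean an infinite
  -- integral.
  have he' : AEStronglyMeasurable e (volume.restrict (Set.Icc 0 T)) :=
    (he.mono fun t ht => ht.1).aestronglyMeasurable measurableSet_Icc
  have hc : Continuous fun y : (Fin p → ℝ) × (Fin m → ℝ) =>
      y.1 ⬝ᵥ (Q *ᵥ y.1) + y.2 ⬝ᵥ (R *ᵥ y.2) := by fun_prop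
  have hm : AEStronglyMeasurable (stageCost Q R e u) (volume.restrict (Set.Icc 0 T)) :=
    hc.comp_aestronglyMeasurable (he'.prodMk hu.aestronglyMeasurable)
  have h1 := (lintegral_ofReal_ne_top_iff_integrable hm
    (Eventually.of_forall fun t => stageCost_nonneg hQ hR e u t)).not.2 h
  rw [not_not] at h1
  rw [cost]
  refine (congrArg (fun y => (1 / 2 : ENNReal) * y) h1).trans ?_
  exact ENNReal.mul_top (by simp)

/-- Stationarity cancels the exosystem's contribution, so the deviation obeys the agent's own
dynamics with input v − G w. -/
theorem IsTrajectory.sub_exoState {x₀ : Fin n → ℝ} {v : ℝ → Fin m → ℝ} {z : ℝ → Fin n → ℝ}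
    (hz : IsTrajectory A B x₀ v z) (hP : P * S = A * P + B * G) (w₀ : Fin q → ℝ) :
    IsVecPrimitive (fun t => z t - P *ᵥ exoState S w₀ t)
      (fun t => A *ᵥ (z t - P *ᵥ exoState S w₀ t) + B *ᵥ (v t - G *ᵥ exoState S w₀ t)) := by
  have h := hz.isVecPrimitive.sub ((isVecPrimitive_exoState S w₀).mulVec P)
  convert h using 2 with t
  rw [Matrix.mulVec_mulVec, hP, Matrix.add_mulVec, Matrix.mulVec_sub, Matrix.mulVec_sub,
    Matrix.mulVec_mulVec, Matrix.mulVec_mulVec]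
  abel

theorem IsTrajectory.continuousOn_syncError {x₀ : Fin n → ℝ} {v : ℝ → Fin m → ℝ}
    {z : ℝ → Fin n → ℝ} (hz : IsTrajectory A B x₀ v z) (w₀ : Fin q → ℝ) :
    ContinuousOn (syncError C D z (exoState S w₀)) (Set.Ici 0) := by
  have h1 : Continuous fun y : Fin n → ℝ => C *ᵥ y := by fun_prop
  have h2 : Continuous fun y : Fin q → ℝ => D *ᵥ y := by fun_prop
  exact (h1.comp_continuousOn hz.state_continuous).sub
    (h2.comp (continuous_exoState S w₀)).continuousOn

theorem SolvesHamiltonianSylvester.stationary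
    (h : SolvesHamiltonianSylvester A B C Q R S D P L G) : P * S = A * P + B * G := by
  obtain ⟨⟨h1, -⟩, h2⟩ := solvesHamiltonianSylvester_iff.1 h
  rw [h1, h2, Matrix.mul_neg, sub_eq_add_neg, ← Matrix.mul_assoc, ← Matrix.mul_assoc]

/-- Completion of the cost around the stationary motion: the cross terms are an exact
derivative. -/
theorem SolvesHamiltonianSylvester.stageCost_eq (hQ : Q.PosDef) (hR : R.PosDef)
    (h : SolvesHamiltonianSylvester A B C Q R S D P L G) (z w : ℝ → Fin _ → ℝ)
    (v : ℝ → Fin m → ℝ) (t : ℝ) :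
    stageCost Q R (syncError C D z w) v t =
      stageCost Q R (fun t => C *ᵥ (z t - P *ᵥ w t)) (fun t => v t - G *ᵥ w t) t -
        2 * ((A *ᵥ (z t - P *ᵥ w t) + B *ᵥ (v t - G *ᵥ w t)) ⬝ᵥ (L *ᵥ w t) +
          (z t - P *ᵥ w t) ⬝ᵥ (L *ᵥ (S *ᵥ w t))) +
        stageCost Q R (fun t => (C * P - D) *ᵥ w t) (fun t => G *ᵥ w t) t := by
  obtain ⟨⟨-, hL⟩, hG⟩ := solvesHamiltonianSylvester_iff.1 h
  have hRG : R * G = -(Bᵀ * L) := by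
    rw [hG, Matrix.mul_neg, Matrix.mul_assoc, ← Matrix.mul_assoc,
      Matrix.mul_nonsing_inv _ ((Matrix.isUnit_iff_isUnit_det R).1 hR.isUnit), Matrix.one_mul]
  obtain ⟨y, hy⟩ : ∃ y, y = w t := ⟨_, rfl⟩
  obtain ⟨ξ, hξ⟩ : ∃ ξ, ξ = z t - P *ᵥ y := ⟨_, rfl⟩
  obtain ⟨ν, hν⟩ : ∃ ν, ν = v t - G *ᵥ y := ⟨_, rfl⟩
  have he : syncError C D z w t = C *ᵥ ξ + (C * P - D) *ᵥ y := by
    rw [hξ, syncError, ← hy, Matrix.mulVec_sub, Matrix.sub_mulVec, Matrix.mulVec_mulVec]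
    abel
  have hv : v t = ν + G *ᵥ y := by rw [hν]; abel
  -- The costate row of the equation supplies the cross term in Q, and the gain formula, as RG =
  -- −BᵀL, the one in R (`e2`).
  have e1 : ξ ⬝ᵥ (L *ᵥ (S *ᵥ y)) =
      -((C *ᵥ ξ) ⬝ᵥ (Q *ᵥ ((C * P - D) *ᵥ y))) - (A *ᵥ ξ) ⬝ᵥ (L *ᵥ y) := by
    have hLS : L * S = -(Cᵀ * (Q * (C * P - D))) - Aᵀ * L := by
      rw [hL, Matrix.mul_sub, Matrix.mul_sub, ← Matrix.mul_assoc, ← Matrix.mul_assoc,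
        ← Matrix.mul_assoc]
      abel
    rw [Matrix.mulVec_mulVec, hLS, Matrix.sub_mulVec, Matrix.neg_mulVec, dotProduct_sub,
      dotProduct_neg, ← Matrix.mulVec_mulVec, ← Matrix.mulVec_mulVec, ← Matrix.mulVec_mulVec,
      Matrix.dotProduct_mulVec _ Cᵀ, Matrix.dotProduct_mulVec _ Aᵀ, Matrix.vecMul_transpose,
      Matrix.vecMul_transpose]
  have e2 : (B *ᵥ ν) ⬝ᵥ (L *ᵥ y) = -(ν ⬝ᵥ (R *ᵥ (G *ᵥ y))) := by
    rw [Matrix.mulVec_mulVec, hRG, Matrix.neg_mulVec, dotProduct_neg, neg_neg,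
      ← Matrix.mulVec_mulVec, Matrix.dotProduct_mulVec _ Bᵀ, Matrix.vecMul_transpose]
  have e3 := dotProduct_mulVec_comm_of_posDef hQ ((C * P - D) *ᵥ y) (C *ᵥ ξ)
  have e4 := dotProduct_mulVec_comm_of_posDef hR (G *ᵥ y) ν
  simp only [stageCost, ← hy, ← hξ, ← hν, he]
  simp only [hv, Matrix.mulVec_add, dotProduct_add, add_dotProduct, e1, e2, e3, e4]
  ring

theorem continuous_stageCost_exoState (M : Matrix (Fin p) (Fin q) ℝ) (N : Matrix (Fin m) (Fin q) ℝ)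
    (Q : Matrix (Fin p) (Fin p) ℝ) (R : Matrix (Fin m) (Fin m) ℝ) (w₀ : Fin q → ℝ) :
    Continuous (stageCost Q R (fun t => M *ᵥ exoState S w₀ t) (fun t => N *ᵥ exoState S w₀ t)) := by
  have hc : Continuous fun y : Fin q → ℝ =>
      (M *ᵥ y) ⬝ᵥ (Q *ᵥ (M *ᵥ y)) + (N *ᵥ y) ⬝ᵥ (R *ᵥ (N *ᵥ y)) := by fun_prop
  exact hc.comp (continuous_exoState S w₀)

theorem SolvesHamiltonianSylvester.isPrimitive_boundary
    (h : SolvesHamiltonianSylvester A B C Q R S D P L G) {x₀ : Fin n → ℝ}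
    {v : ℝ → Fin m → ℝ} {z : ℝ → Fin n → ℝ} (hz : IsTrajectory A B x₀ v z) (w₀ : Fin q → ℝ) :
    IsPrimitive (fun t => (z t - P *ᵥ exoState S w₀ t) ⬝ᵥ (L *ᵥ exoState S w₀ t))
      (fun t => (A *ᵥ (z t - P *ᵥ exoState S w₀ t) + B *ᵥ (v t - G *ᵥ exoState S w₀ t)) ⬝ᵥ
        (L *ᵥ exoState S w₀ t) +
          (z t - P *ᵥ exoState S w₀ t) ⬝ᵥ (L *ᵥ (S *ᵥ exoState S w₀ t))) :=
  (hz.sub_exoState h.stationary w₀).dotProduct ((isVecPrimitive_exoState S w₀).mulVec L)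

/-- Controls need not be square integrable, so finiteness of the cost is a genuine condition. It
passes to the deviation because the two integrands differ by locally integrable terms. -/
theorem SolvesHamiltonianSylvester.locInt_iff (hQ : Q.PosDef) (hR : R.PosDef)
    (h : SolvesHamiltonianSylvester A B C Q R S D P L G) {x₀ : Fin n → ℝ}
    {v : ℝ → Fin m → ℝ} {z : ℝ → Fin n → ℝ} (hz : IsTrajectory A B x₀ v z) (w₀ : Fin q → ℝ) :
    LocInt (stageCost Q R (syncError C D z (exoState S w₀)) v) ↔
      LocInt (stageCost Q R (fun t => C *ᵥ (z t - P *ᵥ exoState S w₀ t))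
        (fun t => v t - G *ᵥ exoState S w₀ t)) := by
  have h1 := ((h.isPrimitive_boundary hz w₀).locInt.const_mul 2)
  have h2 := LocInt.of_continuousOn
    (continuous_stageCost_exoState (S := S) (C * P - D) G Q R w₀).continuousOn
  constructor
  · intro hg
    refine (congrArg LocInt (funext fun t => ?_)).mp ((hg.add h1).sub h2)
    rw [h.stageCost_eq hQ hR]
    ring
  · intro hg
    refine (congrArg LocInt (funext fun t => ?_)).mp ((hg.sub h1).add h2)
    rw [h.stageCost_eq hQ hR]

theorem SolvesHamiltonianSylvester.integral_stageCost (hQ : Q.PosDef) (hR : R.PosDef)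
    (h : SolvesHamiltonianSylvester A B C Q R S D P L G) {x₀ : Fin n → ℝ}
    {v : ℝ → Fin m → ℝ} {z : ℝ → Fin n → ℝ} (hz : IsTrajectory A B x₀ v z) (w₀ : Fin q → ℝ)
    (hg : LocInt (stageCost Q R (fun t => C *ᵥ (z t - P *ᵥ exoState S w₀ t))
        (fun t => v t - G *ᵥ exoState S w₀ t))) {T : ℝ} (hT : 0 ≤ T) :
    ∫ t in (0 : ℝ)..T, stageCost Q R (syncError C D z (exoState S w₀)) v t =
      (∫ t in (0 : ℝ)..T, stageCost Q R (fun t => C *ᵥ (z t - P *ᵥ exoState S w₀ t))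
        (fun t => v t - G *ᵥ exoState S w₀ t) t) -
      2 * ((z T - P *ᵥ exoState S w₀ T) ⬝ᵥ (L *ᵥ exoState S w₀ T) -
        (z 0 - P *ᵥ exoState S w₀ 0) ⬝ᵥ (L *ᵥ exoState S w₀ 0)) +
      ∫ t in (0 : ℝ)..T, stageCost Q R (fun t => (C * P - D) *ᵥ exoState S w₀ t)
        (fun t => G *ᵥ exoState S w₀ t) t := by
  have h0 := h.isPrimitive_boundary hz w₀
  have h1 := h0.locInt.const_mul 2
  have h2 := LocInt.of_continuousOn
    (continuous_stageCost_exoState (S := S) (C * P - D) G Q R w₀).continuousOn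
  rw [h0.sub_eq le_rfl hT, ← intervalIntegral.integral_const_mul,
    ← intervalIntegral.integral_sub (hg T hT) (h1 T hT),
    ← intervalIntegral.integral_add ((hg.sub h1) T hT) (h2 T hT)]
  exact intervalIntegral.integral_congr fun t _ => h.stageCost_eq hQ hR z (exoState S w₀) v t

end CostIdentity
-- State bounds from the cost, tracking trajectories, and cost differences.
section Bounds

variable {n m p q : ℕ}

theorem two_mul_dotProduct_le {k : ℕ} (v w : Fin k → ℝ) {ε : ℝ} (hε : 0 < ε) :
    2 * (v ⬝ᵥ w) ≤ ε * (v ⬝ᵥ v) + ε⁻¹ * (w ⬝ᵥ w) := by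
  have h := dotProduct_self_nonneg_real (ε • v - w)
  simp only [sub_dotProduct, dotProduct_sub, smul_dotProduct, dotProduct_smul, smul_eq_mul] at h
  rw [dotProduct_comm w v] at h
  have h2 := mul_nonneg (inv_nonneg.2 hε.le) h
  have h3 : ε⁻¹ * (ε * (ε * (v ⬝ᵥ v)) - ε * (v ⬝ᵥ w) - (ε * (v ⬝ᵥ w) - w ⬝ᵥ w)) =
      ε * (v ⬝ᵥ v) - 2 * (v ⬝ᵥ w) + ε⁻¹ * (w ⬝ᵥ w) := by
    field_simp
    ring
  linarith

theorem neg_two_mul_dotProduct_le {k : ℕ} (v w : Fin k → ℝ) {ε : ℝ} (hε : 0 < ε) :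
    -(2 * (v ⬝ᵥ w)) ≤ ε * (v ⬝ᵥ v) + ε⁻¹ * (w ⬝ᵥ w) := by
  have := two_mul_dotProduct_le (-v) w hε
  simpa using this

theorem HasSemisimpleImaginarySpectrum.exists_output_bound {S : Matrix (Fin q) (Fin q) ℝ}
    (hS : HasSemisimpleImaginarySpectrum S) {k : ℕ} (M : Matrix (Fin k) (Fin q) ℝ)
    (w₀ : Fin q → ℝ) :
    ∃ c, ∀ t, (M *ᵥ exoState S w₀ t) ⬝ᵥ (M *ᵥ exoState S w₀ t) ≤ c := by
  obtain ⟨b, hb⟩ := hS.exists_norm_exoState_le w₀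
  obtain ⟨d, hd, hM⟩ := exists_mulVec_sq_le M
  refine ⟨d * ∑ _i : Fin q, b * b, fun t => (hM _).trans ?_⟩
  refine mul_le_mul_of_nonneg_left (Finset.sum_le_sum fun i _ => ?_) hd
  have h1 : |exoState S w₀ t i| ≤ b := (norm_le_pi_norm (exoState S w₀ t) i).trans (hb t)
  rw [← abs_mul_abs_self]
  exact mul_self_le_mul_self (abs_nonneg _) h1

variable {A : Matrix (Fin n) (Fin n) ℝ} {B : Matrix (Fin n) (Fin m) ℝ}
  {C : Matrix (Fin p) (Fin n) ℝ} {Q : Matrix (Fin p) (Fin p) ℝ} {R : Matrix (Fin m) (Fin m) ℝ}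

/-- For a detectable system, the cost of a trajectory bounds its state. -/
theorem IsDetectable.exists_state_bound (hdet : IsDetectable A C) (B : Matrix (Fin n) (Fin m) ℝ)
    (hQ : Q.PosDef) (hR : R.PosDef) :
    ∃ c : ℝ, 0 < c ∧ ∀ (ξ : ℝ → Fin n → ℝ) (ν : ℝ → Fin m → ℝ),
      IsVecPrimitive ξ (fun t => A *ᵥ ξ t + B *ᵥ ν t) →
      LocInt (stageCost Q R (fun t => C *ᵥ ξ t) ν) →
        (∀ t, 0 ≤ t → ξ t ⬝ᵥ ξ t ≤
          c * (ξ 0 ⬝ᵥ ξ 0 + ∫ r in (0 : ℝ)..t, stageCost Q R (fun t => C *ᵥ ξ t) ν r)) ∧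
        ((∃ M, ∀ t, 0 ≤ t → ∫ r in (0 : ℝ)..t, stageCost Q R (fun t => C *ᵥ ξ t) ν r ≤ M) →
          Tendsto ξ atTop (𝓝 0)) := by
  obtain ⟨K, hK⟩ := hdet
  obtain ⟨c, hc, hbound⟩ := hK.exists_state_bound
  obtain ⟨b, hb, hB⟩ := exists_mulVec_sq_le B
  obtain ⟨k, hk, hK'⟩ := exists_mulVec_sq_le K
  obtain ⟨α, hα, hQ'⟩ := exists_le_of_posDef hQ
  obtain ⟨β, hβ, hR'⟩ := exists_le_of_posDef hR
  set κ := 2 * b * β + 2 * k * α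
  have hκ : 0 ≤ κ := by positivity
  refine ⟨c * (1 + κ), by positivity, fun ξ ν hξ hg => ?_⟩
  set g := stageCost Q R (fun t => C *ᵥ ξ t) ν
  -- Output injection: Aξ + Bν = (A + KC)ξ + (Bν − KCξ), with A + KC Hurwitz and the squared
  -- disturbance bounded by κ times the stage cost.
  have hd : ∀ t, 0 ≤ t → (B *ᵥ ν t - K *ᵥ (C *ᵥ ξ t)) ⬝ᵥ (B *ᵥ ν t - K *ᵥ (C *ᵥ ξ t)) ≤
      κ * g t := by
    intro t _
    have e1 := neg_two_mul_dotProduct_le (B *ᵥ ν t) (K *ᵥ (C *ᵥ ξ t)) one_pos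
    have e2 := hB (ν t)
    have e3 := hK' (C *ᵥ ξ t)
    have e4 := mul_le_mul_of_nonneg_left (hQ' (C *ᵥ ξ t)).1 hk
    have e5 := mul_le_mul_of_nonneg_left (hR' (ν t)).1 hb
    have e6 := mul_nonneg (by positivity : 0 ≤ 2 * b * β) (posDef_nonneg hQ (C *ᵥ ξ t))
    have e7 := mul_nonneg (by positivity : 0 ≤ 2 * k * α) (posDef_nonneg hR (ν t))
    simp only [sub_dotProduct, dotProduct_sub]
    rw [dotProduct_comm (K *ᵥ (C *ᵥ ξ t)) (B *ᵥ ν t)]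
    simp only [g, stageCost, κ]
    linarith
  have hξ' : IsVecPrimitive ξ (fun t => (A + K * C) *ᵥ ξ t + (B *ᵥ ν t - K *ᵥ (C *ᵥ ξ t))) := by
    convert hξ using 2 with t
    rw [Matrix.add_mulVec, ← Matrix.mulVec_mulVec]
    abel
  obtain ⟨h1, -, h3⟩ := hbound ξ _ _ hξ' (hg.const_mul κ) hd
  have hI : ∀ t, 0 ≤ t → 0 ≤ ∫ r in (0 : ℝ)..t, g r := fun t ht =>
    intervalIntegral.integral_nonneg ht fun r _ => stageCost_nonneg hQ hR _ _ r
  refine ⟨fun t ht => (h1 t ht).trans ?_, ?_⟩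
  · rw [intervalIntegral.integral_const_mul, mul_assoc]
    refine mul_le_mul_of_nonneg_left ?_ hc.le
    have := mul_nonneg hκ (dotProduct_self_nonneg_real (ξ 0))
    linarith [hI t ht]
  · rintro ⟨M, hM⟩
    refine h3 ⟨κ * M, fun t ht => ?_⟩
    rw [intervalIntegral.integral_const_mul]
    exact mul_le_mul_of_nonneg_left (hM t ht) hκ

variable {S : Matrix (Fin q) (Fin q) ℝ} {D : Matrix (Fin p) (Fin q) ℝ}
  {P L : Matrix (Fin n) (Fin q) ℝ} {G : Matrix (Fin m) (Fin q) ℝ} {K : Matrix (Fin m) (Fin n) ℝ}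

/-- Under the tracking control the deviation from the stationary motion is square integrable and
tends to zero. -/
theorem tracking_deviation (hK : IsHurwitz (A - B * K)) (hP : P * S = A * P + B * G)
    {x₀ : Fin n → ℝ} {w₀ : Fin q → ℝ} {x : ℝ → Fin n → ℝ}
    (hx : IsTrajectory A B x₀ (trackingControl K P G x (exoState S w₀)) x) :
    ∃ M : ℝ,
      (∀ t, 0 ≤ t →
        (x t - P *ᵥ exoState S w₀ t) ⬝ᵥ (x t - P *ᵥ exoState S w₀ t) ≤ M) ∧
      (∀ T, 0 ≤ T →
        ∫ t in (0 : ℝ)..T, (x t - P *ᵥ exoState S w₀ t) ⬝ᵥ (x t - P *ᵥ exoState S w₀ t) ≤ M) ∧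
      Tendsto (fun t => x t - P *ᵥ exoState S w₀ t) atTop (𝓝 0) := by
  obtain ⟨c, hc, hbound⟩ := hK.exists_state_bound
  have h0 := hx.sub_exoState hP w₀
  have h1 : IsVecPrimitive (fun t => x t - P *ᵥ exoState S w₀ t)
      (fun t => (A - B * K) *ᵥ (x t - P *ᵥ exoState S w₀ t) + 0) := by
    convert h0 using 2 with t
    rw [trackingControl, add_sub_cancel_right, Matrix.sub_mulVec, ← Matrix.mulVec_mulVec,
      Matrix.mulVec_neg, add_zero, sub_eq_add_neg]
  obtain ⟨h2, h3, h4⟩ := hbound _ (fun _ => 0) (fun _ => 0) h1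
    (LocInt.of_continuousOn continuousOn_const) (fun t _ => by simp)
  simp only [intervalIntegral.integral_zero, add_zero] at h2 h3 h4
  exact ⟨_, h2, h3, h4 ⟨0, fun _ _ => le_rfl⟩⟩

theorem exists_tracking_trajectory (A : Matrix (Fin n) (Fin n) ℝ) (B : Matrix (Fin n) (Fin m) ℝ)
    (K : Matrix (Fin m) (Fin n) ℝ) (hP : P * S = A * P + B * G)
    (x₀ : Fin n → ℝ) (w₀ : Fin q → ℝ) :
    ∃ x, IsTrajectory A B x₀ (trackingControl K P G x (exoState S w₀)) x := by
  -- Under the tracking control the deviation from P w solves the autonomous equation with matrix A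
  -- − BK.
  let x : ℝ → Fin n → ℝ := fun t =>
    P *ᵥ exoState S w₀ t + exoState (A - B * K) (x₀ - P *ᵥ w₀) t
  have hw := continuous_exoState S w₀
  have hη := continuous_exoState (A - B * K) (x₀ - P *ᵥ w₀)
  have hPd : ∀ t, HasDerivAt (fun t => P *ᵥ exoState S w₀ t) (P *ᵥ (S *ᵥ exoState S w₀ t)) t :=
    fun t => (LinearMap.toContinuousLinearMap (Matrix.toLin' P)).hasFDerivAt.comp_hasDerivAt t
      (hasDerivAt_exoState S w₀ t)
  have hcx : Continuous x := (continuous_const.matrix_mulVec hw).add hη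
  have hu : Continuous (trackingControl K P G x (exoState S w₀)) :=
    (continuous_const.matrix_mulVec
      (hcx.sub (continuous_const.matrix_mulVec hw))).neg.add (continuous_const.matrix_mulVec hw)
  have h := IsTrajectory.of_hasDerivAt (A := A) (B := B) (x := x) hu fun t => by
    convert! (hPd t).add (hasDerivAt_exoState (A - B * K) (x₀ - P *ᵥ w₀) t) using 1
    simp only [x, trackingControl, add_sub_cancel_left]
    rw [Matrix.mulVec_mulVec _ P S, hP, Matrix.add_mulVec, Matrix.sub_mulVec, Matrix.mulVec_add,
      Matrix.mulVec_add, Matrix.mulVec_neg, Matrix.mulVec_mulVec, Matrix.mulVec_mulVec,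
      Matrix.mulVec_mulVec]
    abel
  have h0 : x 0 = x₀ := by simp [x, exoState_zero]
  rw [h0] at h
  exact ⟨x, h⟩

/-- Here G' is a reference gain that may differ from the gain G of the control; the surplus (G −
G')w is what makes a wrong gain expensive. -/
theorem trackingControl_sub (x : ℝ → Fin n → ℝ) (w : ℝ → Fin q → ℝ) (G' : Matrix (Fin m) (Fin q) ℝ)
    (t : ℝ) : trackingControl K P G x w t - G' *ᵥ w t =
      -(K *ᵥ (x t - P *ᵥ w t)) + (G - G') *ᵥ w t := by
  rw [trackingControl, Matrix.sub_mulVec]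
  abel

theorem continuousOn_mulVec {k l : ℕ} (M : Matrix (Fin k) (Fin l) ℝ) {f : ℝ → Fin l → ℝ}
    {s : Set ℝ} (hf : ContinuousOn f s) : ContinuousOn (fun t => M *ᵥ f t) s := by
  have hc : Continuous fun y : Fin l → ℝ => M *ᵥ y := by fun_prop
  exact hc.comp_continuousOn hf

theorem continuousOn_stageCost {e : ℝ → Fin p → ℝ} {u : ℝ → Fin m → ℝ} {s : Set ℝ}
    (he : ContinuousOn e s) (hu : ContinuousOn u s) : ContinuousOn (stageCost Q R e u) s := by
  have hc : Continuous fun y : (Fin p → ℝ) × (Fin m → ℝ) =>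
      y.1 ⬝ᵥ (Q *ᵥ y.1) + y.2 ⬝ᵥ (R *ᵥ y.2) := by fun_prop
  exact hc.comp_continuousOn (he.prodMk hu)

theorem IsTrajectory.locInt_tracking {G' : Matrix (Fin m) (Fin q) ℝ} {x₀ : Fin n → ℝ}
    {w₀ : Fin q → ℝ} {x : ℝ → Fin n → ℝ}
    (hx : IsTrajectory A B x₀ (trackingControl K P G x (exoState S w₀)) x) :
    LocInt (stageCost Q R (fun t => C *ᵥ (x t - P *ᵥ exoState S w₀ t))
        (fun t => trackingControl K P G x (exoState S w₀) t - G' *ᵥ exoState S w₀ t)) := by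
  have hw := (continuous_exoState S w₀).continuousOn (s := Set.Ici 0)
  have hξ : ContinuousOn (fun t => x t - P *ᵥ exoState S w₀ t) (Set.Ici 0) :=
    hx.state_continuous.sub (continuousOn_mulVec P hw)
  refine LocInt.of_continuousOn (continuousOn_stageCost (continuousOn_mulVec C hξ) ?_)
  exact ((continuousOn_mulVec K hξ).neg.add (continuousOn_mulVec G hw)).sub
    (continuousOn_mulVec G' hw)

/-- The stationary part depends on w alone and drops out, leaving excess costs and boundary terms.
-/
theorem cost_sub_cost_eq (hQ : Q.PosDef) (hR : R.PosDef)
    (h : SolvesHamiltonianSylvester A B C Q R S D P L G) {w₀ : Fin q → ℝ} {x₀ z₀ : Fin n → ℝ}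
    {u v : ℝ → Fin m → ℝ} {x z : ℝ → Fin n → ℝ}
    (hx : IsTrajectory A B x₀ u x) (hz : IsTrajectory A B z₀ v z)
    (hgx : LocInt (stageCost Q R (fun t => C *ᵥ (x t - P *ᵥ exoState S w₀ t))
        (fun t => u t - G *ᵥ exoState S w₀ t)))
    (hgz : LocInt (stageCost Q R (fun t => C *ᵥ (z t - P *ᵥ exoState S w₀ t))
        (fun t => v t - G *ᵥ exoState S w₀ t))) {T : ℝ} (hT : 0 ≤ T) :
    ((cost Q R T (syncError C D z (exoState S w₀)) v : ENNReal) : EReal) -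
        ((cost Q R T (syncError C D x (exoState S w₀)) u : ENNReal) : EReal) =
      ((1 / 2 * (∫ t in (0 : ℝ)..T, stageCost Q R (fun t => C *ᵥ (z t - P *ᵥ exoState S w₀ t))
          (fun t => v t - G *ᵥ exoState S w₀ t) t) -
        1 / 2 * (∫ t in (0 : ℝ)..T, stageCost Q R (fun t => C *ᵥ (x t - P *ᵥ exoState S w₀ t))
          (fun t => u t - G *ᵥ exoState S w₀ t) t) -
        ((z T - P *ᵥ exoState S w₀ T) ⬝ᵥ (L *ᵥ exoState S w₀ T) -
          (z 0 - P *ᵥ exoState S w₀ 0) ⬝ᵥ (L *ᵥ exoState S w₀ 0)) +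
        ((x T - P *ᵥ exoState S w₀ T) ⬝ᵥ (L *ᵥ exoState S w₀ T) -
          (x 0 - P *ᵥ exoState S w₀ 0) ⬝ᵥ (L *ᵥ exoState S w₀ 0)) : ℝ) : EReal) := by
  rw [cost_eq hQ hR hT ((h.locInt_iff hQ hR hz w₀).2 hgz T hT),
    cost_eq hQ hR hT ((h.locInt_iff hQ hR hx w₀).2 hgx T hT), ← EReal.coe_sub,
    h.integral_stageCost hQ hR hz w₀ hgz hT, h.integral_stageCost hQ hR hx w₀ hgx hT]
  congr 1
  ring

end Bounds

/-! ### Sufficiency, and uniqueness of the stationary state. -/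

section Optimality

variable {n m p q : ℕ} {A : Matrix (Fin n) (Fin n) ℝ} {B : Matrix (Fin n) (Fin m) ℝ}
  {C : Matrix (Fin p) (Fin n) ℝ} {Q : Matrix (Fin p) (Fin p) ℝ} {R : Matrix (Fin m) (Fin m) ℝ}
  {S : Matrix (Fin q) (Fin q) ℝ} {D : Matrix (Fin p) (Fin q) ℝ}
  {P L : Matrix (Fin n) (Fin q) ℝ} {G : Matrix (Fin m) (Fin q) ℝ} {K : Matrix (Fin m) (Fin n) ℝ}

/-- The deviation cost of the tracking control of a stationary pair is bounded. -/
theorem tracking_excess_bounded (hQ : Q.PosDef) (hR : R.PosDef) (C : Matrix (Fin p) (Fin n) ℝ)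
    (hK : IsHurwitz (A - B * K)) (hP : P * S = A * P + B * G)
    {x₀ : Fin n → ℝ} {w₀ : Fin q → ℝ} {x : ℝ → Fin n → ℝ}
    (hx : IsTrajectory A B x₀ (trackingControl K P G x (exoState S w₀)) x) :
    ∃ M : ℝ, ∀ T, 0 ≤ T →
      ∫ t in (0 : ℝ)..T, stageCost Q R (fun t => C *ᵥ (x t - P *ᵥ exoState S w₀ t))
        (fun t => trackingControl K P G x (exoState S w₀) t - G *ᵥ exoState S w₀ t) t ≤ M := by
  obtain ⟨M, -, hM, -⟩ := tracking_deviation hK hP hx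
  obtain ⟨a, ha, hC⟩ := exists_mulVec_sq_le C
  obtain ⟨b, hb, hK'⟩ := exists_mulVec_sq_le K
  obtain ⟨α, hα, hQ'⟩ := exists_le_of_posDef hQ
  obtain ⟨β, hβ, hR'⟩ := exists_le_of_posDef hR
  have hsq : LocInt fun t => (x t - P *ᵥ exoState S w₀ t) ⬝ᵥ (x t - P *ᵥ exoState S w₀ t) :=
    LocInt.of_continuousOn
      ((hx.sub_exoState hP w₀).dotProduct (hx.sub_exoState hP w₀)).continuousOn
  refine ⟨(α * a + β * b) * M, fun T hT => ?_⟩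
  have h1 : ∀ t, stageCost Q R (fun t => C *ᵥ (x t - P *ᵥ exoState S w₀ t))
      (fun t => trackingControl K P G x (exoState S w₀) t - G *ᵥ exoState S w₀ t) t ≤
        (α * a + β * b) *
          ((x t - P *ᵥ exoState S w₀ t) ⬝ᵥ (x t - P *ᵥ exoState S w₀ t)) := fun t => by
    rw [stageCost, trackingControl_sub, sub_self, Matrix.zero_mulVec, add_zero, Matrix.mulVec_neg,
      neg_dotProduct, dotProduct_neg, neg_neg]
    set ξ := x t - P *ᵥ exoState S w₀ t
    have e1 := (hQ' (C *ᵥ ξ)).2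
    have e2 := (hR' (K *ᵥ ξ)).2
    have e3 := mul_le_mul_of_nonneg_left (hC ξ) hα.le
    have e4 := mul_le_mul_of_nonneg_left (hK' ξ) hβ.le
    linarith
  calc _ ≤ ∫ t in (0 : ℝ)..T, (α * a + β * b) *
          ((x t - P *ᵥ exoState S w₀ t) ⬝ᵥ (x t - P *ᵥ exoState S w₀ t)) :=
        intervalIntegral.integral_mono_on hT (hx.locInt_tracking T hT)
          ((hsq.const_mul _) T hT) fun t _ => h1 t
    _ ≤ _ := by
        rw [intervalIntegral.integral_const_mul]
        exact mul_le_mul_of_nonneg_left (hM T hT) (by positivity)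

/-- Solutions of the Hamiltonian Sylvester equation achieve optimal stationary synchronization. -/
theorem SolvesHamiltonianSylvester.isOptimalStationarySync (hQ : Q.PosDef) (hR : R.PosDef)
    (hdet : IsDetectable A C) (hS : HasSemisimpleImaginarySpectrum S)
    (hK : IsHurwitz (A - B * K)) (h : SolvesHamiltonianSylvester A B C Q R S D P L G) :
    IsOptimalStationarySync A B C Q R S D K P G := by
  refine ⟨h.stationary, fun w₀ x₀ x hx v z hz hnot => ?_⟩
  have hgx : LocInt (stageCost Q R (fun t => C *ᵥ (x t - P *ᵥ exoState S w₀ t))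
      (fun t => trackingControl K P G x (exoState S w₀) t - G *ᵥ exoState S w₀ t)) :=
    hx.locInt_tracking
  by_cases hg : LocInt (stageCost Q R (syncError C D z (exoState S w₀)) v)
  · have hgz := (h.locInt_iff hQ hR hz w₀).1 hg
    obtain ⟨c, hc, hstate⟩ := hdet.exists_state_bound B hQ hR
    obtain ⟨hb, hconv⟩ := hstate _ _ (hz.sub_exoState h.stationary w₀) hgz
    obtain ⟨Mx, hMx⟩ := tracking_excess_bounded hQ hR C hK h.stationary hx
    obtain ⟨Mη, hMη, -⟩ := tracking_deviation hK h.stationary hx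
    obtain ⟨Mw, hMw⟩ := hS.exists_output_bound L w₀
    set E : ℝ → ℝ := fun T => ∫ t in (0 : ℝ)..T,
      stageCost Q R (fun t => C *ᵥ (z t - P *ᵥ exoState S w₀ t))
        (fun t => v t - G *ᵥ exoState S w₀ t) t with hE
    -- The excess is nondecreasing, and if it were bounded, detectability would force convergence to
    -- P w.
    have hEtop : Tendsto E atTop atTop := by
      rw [tendsto_atTop]
      intro M
      have : ∃ T, 0 ≤ T ∧ M < E T := by
        by_contra! hcon
        exact hnot (hconv ⟨M, hcon⟩)
      obtain ⟨T, hT, hMT⟩ := this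
      filter_upwards [eventually_ge_atTop T] with t ht
      refine hMT.le.trans ?_
      rw [← sub_nonneg]
      simp only [hE]
      rw [intervalIntegral.integral_interval_sub_left (hgz t (hT.trans ht)) (hgz T hT)]
      exact intervalIntegral.integral_nonneg ht fun r _ => stageCost_nonneg hQ hR _ _ r
    obtain ⟨M, hM⟩ : ∃ M : ℝ, ∀ T, 0 ≤ T →
        1 / 4 * E T + M ≤ 1 / 2 * E T -
          1 / 2 * (∫ t in (0 : ℝ)..T, stageCost Q R (fun t => C *ᵥ (x t - P *ᵥ exoState S w₀ t))
            (fun t => trackingControl K P G x (exoState S w₀) t - G *ᵥ exoState S w₀ t) t) -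
          ((z T - P *ᵥ exoState S w₀ T) ⬝ᵥ (L *ᵥ exoState S w₀ T) -
            (z 0 - P *ᵥ exoState S w₀ 0) ⬝ᵥ (L *ᵥ exoState S w₀ 0)) +
          ((x T - P *ᵥ exoState S w₀ T) ⬝ᵥ (L *ᵥ exoState S w₀ T) -
            (x 0 - P *ᵥ exoState S w₀ 0) ⬝ᵥ (L *ᵥ exoState S w₀ 0)) := by
      refine ⟨-(1 / 2 * Mx) - 1 / 4 *
          ((z 0 - P *ᵥ exoState S w₀ 0) ⬝ᵥ (z 0 - P *ᵥ exoState S w₀ 0)) - c * Mw -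
          1 / 2 * Mη - 1 / 2 * Mw +
          (z 0 - P *ᵥ exoState S w₀ 0) ⬝ᵥ (L *ᵥ exoState S w₀ 0) -
          (x 0 - P *ᵥ exoState S w₀ 0) ⬝ᵥ (L *ᵥ exoState S w₀ 0), fun T hT => ?_⟩
      have e1 := hMx T hT
      -- With ε = 1/(2c) the state bound makes the boundary term cost at most a quarter of E(T) plus
      -- a constant, out of the available half.
      have e2 := two_mul_dotProduct_le (z T - P *ᵥ exoState S w₀ T) (L *ᵥ exoState S w₀ T)
        (ε := (2 * c)⁻¹) (by positivity)
      have e3 := neg_two_mul_dotProduct_le (x T - P *ᵥ exoState S w₀ T) (L *ᵥ exoState S w₀ T)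
        one_pos
      have e4 := mul_le_mul_of_nonneg_left (hb T hT) (by positivity : 0 ≤ (2 * c)⁻¹)
      have e5 : (2 * c)⁻¹ * (c * ((z 0 - P *ᵥ exoState S w₀ 0) ⬝ᵥ (z 0 - P *ᵥ exoState S w₀ 0) +
          E T)) = 1 / 2 * ((z 0 - P *ᵥ exoState S w₀ 0) ⬝ᵥ (z 0 - P *ᵥ exoState S w₀ 0) + E T) := by
        field_simp
      have e6 := mul_le_mul_of_nonneg_left (hMw T) (by positivity : 0 ≤ 2 * c)
      have e7 := hMw T
      have e8 := hMη T hT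
      rw [inv_inv] at e2
      rw [inv_one, one_mul, one_mul] at e3
      change _ ≤ (2 * c)⁻¹ * (c * (_ + E T)) at e4
      linarith
    have hlim : Tendsto (fun T => 1 / 4 * E T + M) atTop atTop :=
      tendsto_atTop_add_const_right _ _ (hEtop.const_mul_atTop (by norm_num))
    have hgap := tendsto_atTop_mono' atTop ((eventually_ge_atTop 0).mono hM) hlim
    refine (EReal.tendsto_coe_nhds_top_iff.2 hgap).congr' ?_
    filter_upwards [eventually_ge_atTop 0] with T hT
    exact (cost_sub_cost_eq hQ hR h hx hz hgx hgz hT).symm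
  -- Otherwise the competitor's cost is infinite from T₀ on, while the tracking cost is finite at
  -- every horizon.
  · simp only [LocInt, not_forall] at hg
    obtain ⟨T₀, hT₀, hg⟩ := hg
    refine tendsto_const_nhds.congr' ?_
    filter_upwards [eventually_ge_atTop T₀] with T hT
    have hT0 := hT₀.trans hT
    rw [cost_eq_top hQ hR hT0 (hz.continuousOn_syncError w₀) (hz.control_integrable T hT0)
      fun hcon => hg (hcon.mono_set (by
        rw [Set.uIcc_of_le hT₀, Set.uIcc_of_le hT0]
        exact Set.Icc_subset_Icc_right hT)),
      cost_eq hQ hR hT0 ((h.locInt_iff hQ hR hx w₀).2 hgx T hT0), EReal.coe_ennreal_top,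
      EReal.top_sub_coe]

theorem not_tendsto_zero_of_persistent {k : ℕ} {M : Matrix (Fin k) (Fin q) ℝ}
    (hS : HasSemisimpleImaginarySpectrum S) (hM : M ≠ 0) :
    ∃ w₀, ¬ Tendsto (fun t => M *ᵥ exoState S w₀ t) atTop (𝓝 0) := by
  obtain ⟨a, b, δ, hδ, h⟩ := hS.exists_persistent hM
  by_contra! hcon
  have hsq : ∀ w₀, Tendsto (fun t => (M *ᵥ exoState S w₀ t) ⬝ᵥ (M *ᵥ exoState S w₀ t)) atTop
      (𝓝 0) := fun w₀ => by
    have hc : Continuous fun y : Fin k → ℝ => y ⬝ᵥ y := by fun_prop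
    simpa [Function.comp_def] using (hc.tendsto 0).comp (hcon w₀)
  have h1 := (hsq a).add (hsq b)
  simp only [h, add_zero] at h1
  exact hδ.ne' (tendsto_nhds_unique tendsto_const_nhds h1)

/-- Two pairs achieving optimal stationary synchronization have the same stationary state. -/
theorem IsOptimalStationarySync.state_unique (hS : HasSemisimpleImaginarySpectrum S)
    (hK : IsHurwitz (A - B * K)) {P' : Matrix (Fin n) (Fin q) ℝ} {G' : Matrix (Fin m) (Fin q) ℝ}
    (h : IsOptimalStationarySync A B C Q R S D K P G)
    (h' : IsOptimalStationarySync A B C Q R S D K P' G') : P = P' := by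
  by_contra hne
  obtain ⟨w₀, hw₀⟩ := not_tendsto_zero_of_persistent hS (sub_ne_zero.2 hne)
  -- Each tracking trajectory, started from the common state 0, is a competitor for the other pair;
  -- both cost gaps would be positive at a common horizon.
  obtain ⟨x, hx⟩ := exists_tracking_trajectory A B K h.stationary 0 w₀
  obtain ⟨z, hz⟩ := exists_tracking_trajectory A B K h'.stationary 0 w₀
  obtain ⟨-, -, -, hx0⟩ := tracking_deviation hK h.stationary hx
  obtain ⟨-, -, -, hz0⟩ := tracking_deviation hK h'.stationary hz
  have h1 := h.optimal w₀ 0 x hx _ z hz fun hcon => hw₀ (by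
    simpa [Matrix.sub_mulVec] using hz0.sub hcon)
  have h2 := h'.optimal w₀ 0 z hz _ x hx fun hcon => hw₀ (by
    simpa [Matrix.sub_mulVec] using hcon.sub hx0)
  obtain ⟨T, hT1, hT2⟩ := ((h1.eventually (lt_mem_nhds EReal.zero_lt_top)).and
    (h2.eventually (lt_mem_nhds EReal.zero_lt_top))).exists
  rw [EReal.sub_pos] at hT1 hT2
  exact lt_asymm hT1 hT2

end Optimality
-- Uniqueness of the feedforward gain.
section ControlUniqueness

variable {n m p q : ℕ} {A : Matrix (Fin n) (Fin n) ℝ} {B : Matrix (Fin n) (Fin m) ℝ}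
  {C : Matrix (Fin p) (Fin n) ℝ} {Q : Matrix (Fin p) (Fin p) ℝ} {R : Matrix (Fin m) (Fin m) ℝ}
  {S : Matrix (Fin q) (Fin q) ℝ} {D : Matrix (Fin p) (Fin q) ℝ}
  {P L : Matrix (Fin n) (Fin q) ℝ} {G : Matrix (Fin m) (Fin q) ℝ} {K : Matrix (Fin m) (Fin n) ℝ}

/-- A motion with constant deviation from the stationary one. -/
theorem isTrajectory_of_equilibrium (hP : P * S = A * P + B * G) {ξ : Fin n → ℝ} {ν : Fin m → ℝ}
    (hξ : A *ᵥ ξ + B *ᵥ ν = 0) (w₀ : Fin q → ℝ) :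
    IsTrajectory A B (P *ᵥ w₀ + ξ) (fun t => G *ᵥ exoState S w₀ t + ν)
      (fun t => P *ᵥ exoState S w₀ t + ξ) := by
  have hw := continuous_exoState S w₀
  have hPd : ∀ t, HasDerivAt (fun t => P *ᵥ exoState S w₀ t) (P *ᵥ (S *ᵥ exoState S w₀ t)) t :=
    fun t => (LinearMap.toContinuousLinearMap (Matrix.toLin' P)).hasFDerivAt.comp_hasDerivAt t
      (hasDerivAt_exoState S w₀ t)
  have h := IsTrajectory.of_hasDerivAt (A := A) (B := B)
    (u := fun t => G *ᵥ exoState S w₀ t + ν) (x := fun t => P *ᵥ exoState S w₀ t + ξ)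
    ((continuous_const.matrix_mulVec hw).add continuous_const) fun t => by
      convert! (hPd t).add_const ξ using 1
      rw [Matrix.mulVec_mulVec _ P S, hP, Matrix.add_mulVec, Matrix.mulVec_add, Matrix.mulVec_add,
        Matrix.mulVec_mulVec, Matrix.mulVec_mulVec, add_add_add_comm, hξ, add_zero]
  simpa [exoState_zero] using h

/-- A tracking control whose feedforward gain differs from the one of the Hamiltonian Sylvester
equation, compared with a motion of constant deviation. -/
theorem IsOptimalStationarySync.eventually_lt (hQ : Q.PosDef) (hR : R.PosDef)
    (hS : HasSemisimpleImaginarySpectrum S) (hK : IsHurwitz (A - B * K))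
    {G' : Matrix (Fin m) (Fin q) ℝ} (h : SolvesHamiltonianSylvester A B C Q R S D P L G)
    (hopt : IsOptimalStationarySync A B C Q R S D K P G')
    {c : ℝ} (hc : 0 < c) (hRc : ∀ v, v ⬝ᵥ v ≤ c * (v ⬝ᵥ (R *ᵥ v)))
    {ξ : Fin n → ℝ} {ν : Fin m → ℝ} (hξ : A *ᵥ ξ + B *ᵥ ν = 0) (hξ0 : ξ ≠ 0) (w₀ : Fin q → ℝ) :
    ∀ᶠ T : ℝ in atTop,
      ∫ t in (0 : ℝ)..T, ((G' - G) *ᵥ exoState S w₀ t) ⬝ᵥ ((G' - G) *ᵥ exoState S w₀ t) <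
        2 * c * (T * ((C *ᵥ ξ) ⬝ᵥ (Q *ᵥ (C *ᵥ ξ)) + ν ⬝ᵥ (R *ᵥ ν))) := by
  set w := exoState S w₀ with hw_def
  have hw : Continuous w := continuous_exoState S w₀
  obtain ⟨x, hx⟩ := exists_tracking_trajectory A B K hopt.stationary (P *ᵥ w₀ + ξ) w₀
  have hz := isTrajectory_of_equilibrium h.stationary hξ w₀
  have hlim := hopt.optimal w₀ _ x hx _ _ hz (by
    simp only [add_sub_cancel_left]
    exact fun hcon => hξ0 (tendsto_nhds_unique tendsto_const_nhds hcon))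
  have hgx : LocInt (stageCost Q R (fun t => C *ᵥ (x t - P *ᵥ w t))
      (fun t => trackingControl K P G' x w t - G *ᵥ w t)) := hx.locInt_tracking
  have hgz : LocInt (stageCost Q R (fun t => C *ᵥ (P *ᵥ w t + ξ - P *ᵥ w t))
      (fun t => G *ᵥ w t + ν - G *ᵥ w t)) := by
    simp only [add_sub_cancel_left]
    exact LocInt.of_continuousOn (continuousOn_stageCost continuousOn_const continuousOn_const)
  have hgap := EReal.tendsto_coe_nhds_top_iff.1 (hlim.congr' ((eventually_ge_atTop 0).mono
    fun T hT => cost_sub_cost_eq hQ hR h hx hz hgx hgz hT))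
  have hconst : ∀ t : ℝ, stageCost Q R (fun _ => C *ᵥ ξ) (fun _ => ν) t =
      (C *ᵥ ξ) ⬝ᵥ (Q *ᵥ (C *ᵥ ξ)) + ν ⬝ᵥ (R *ᵥ ν) := fun _ => rfl
  simp only [← hw_def, add_sub_cancel_left, hconst, intervalIntegral.integral_const, sub_zero,
    smul_eq_mul] at hgap
  obtain ⟨Mη, hMη, hMI, -⟩ := tracking_deviation hK hopt.stationary hx
  obtain ⟨Mw, hMw⟩ := hS.exists_output_bound L w₀
  obtain ⟨b, hb, hK'⟩ := exists_mulVec_sq_le K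
  obtain ⟨β, hβ, hR'⟩ := exists_le_of_posDef hR
  simp only [← hw_def] at hMη hMI hMw
  have hsq : LocInt fun t => (x t - P *ᵥ w t) ⬝ᵥ (x t - P *ᵥ w t) :=
    LocInt.of_continuousOn ((hx.sub_exoState hopt.stationary w₀).dotProduct
      (hx.sub_exoState hopt.stationary w₀)).continuousOn
  have hN : LocInt fun t => ((G' - G) *ᵥ w t) ⬝ᵥ ((G' - G) *ᵥ w t) := by
    have hcont : Continuous fun y : Fin q → ℝ => ((G' - G) *ᵥ y) ⬝ᵥ ((G' - G) *ᵥ y) := by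
      fun_prop
    exact LocInt.of_continuousOn (hcont.comp hw).continuousOn
  -- With y = (G' − G)w and η the deviation, nonnegativity of the R-form at y − 2Kη shows that the
  -- R-form at y − Kη is at least half that at y minus that at Kη; the latter has bounded integral.
  have hlow : ∀ T, 0 ≤ T →
      (2 * c)⁻¹ * (∫ t in (0 : ℝ)..T, ((G' - G) *ᵥ w t) ⬝ᵥ ((G' - G) *ᵥ w t)) - β * b * Mη ≤
        ∫ t in (0 : ℝ)..T, stageCost Q R (fun t => C *ᵥ (x t - P *ᵥ w t))
          (fun t => trackingControl K P G' x w t - G *ᵥ w t) t := by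
    intro T hT
    have h1 := intervalIntegral.integral_mono_on hT
      (((hN.const_mul (2 * c)⁻¹).sub (hsq.const_mul (β * b))) T hT) (hgx T hT) fun t _ => by
        rw [stageCost, trackingControl_sub]
        set η := x t - P *ᵥ w t
        set y := (G' - G) *ᵥ w t
        have e1 := posDef_nonneg hQ (C *ᵥ η)
        have e2 := posDef_nonneg hR (y - (2 : ℝ) • (K *ᵥ η))
        have e3 := (hR' (K *ᵥ η)).2
        have e4 := mul_le_mul_of_nonneg_left (hK' η) hβ.le
        have e5 := mul_le_mul_of_nonneg_left (hRc y) (by positivity : 0 ≤ (2 * c)⁻¹)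
        have e6 : (2 * c)⁻¹ * (c * (y ⬝ᵥ (R *ᵥ y))) = 1 / 2 * (y ⬝ᵥ (R *ᵥ y)) := by field_simp
        have e7 := dotProduct_mulVec_comm_of_posDef hR y (K *ᵥ η)
        simp only [Matrix.mulVec_sub, Matrix.mulVec_smul, dotProduct_sub, sub_dotProduct,
          smul_dotProduct, dotProduct_smul, smul_eq_mul] at e2
        simp only [Matrix.mulVec_add, Matrix.mulVec_neg, dotProduct_add, add_dotProduct,
          neg_dotProduct, dotProduct_neg]
        linarith
    rw [intervalIntegral.integral_sub ((hN.const_mul _) T hT) ((hsq.const_mul _) T hT),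
      intervalIntegral.integral_const_mul, intervalIntegral.integral_const_mul] at h1
    have h2 := mul_le_mul_of_nonneg_left (hMI T hT) (by positivity : 0 ≤ β * b)
    linarith
  filter_upwards [eventually_ge_atTop 0, hgap.eventually_gt_atTop
    (1 / 2 * (β * b * Mη) + 1 / 2 * (ξ ⬝ᵥ ξ) + 1 / 2 * Mw + ξ ⬝ᵥ (L *ᵥ w 0) + 1 / 2 * Mη +
      1 / 2 * Mw - (x 0 - P *ᵥ w 0) ⬝ᵥ (L *ᵥ w 0))] with T hT hTgap
  have e1 := hlow T hT
  have e2 := neg_two_mul_dotProduct_le ξ (L *ᵥ w T) one_pos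
  have e3 := two_mul_dotProduct_le (x T - P *ᵥ w T) (L *ᵥ w T) one_pos
  have e4 := hMw T
  have e5 := hMη T hT
  rw [inv_one, one_mul, one_mul] at e2 e3
  have e6 : (2 * c)⁻¹ * (∫ t in (0 : ℝ)..T, ((G' - G) *ᵥ w t) ⬝ᵥ ((G' - G) *ᵥ w t)) <
      T * ((C *ᵥ ξ) ⬝ᵥ (Q *ᵥ (C *ᵥ ξ)) + ν ⬝ᵥ (R *ᵥ ν)) := by linarith
  rwa [inv_mul_lt_iff₀ (by positivity)] at e6

/-- The feedforward gain of a pair achieving optimal stationary synchronization is determined. -/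
theorem IsOptimalStationarySync.control_unique (hQ : Q.PosDef) (hR : R.PosDef) (hB : B ≠ 0)
    (hS : HasSemisimpleImaginarySpectrum S) (hK : IsHurwitz (A - B * K))
    {G' : Matrix (Fin m) (Fin q) ℝ} (h : SolvesHamiltonianSylvester A B C Q R S D P L G)
    (hopt : IsOptimalStationarySync A B C Q R S D K P G') : G' = G := by
  by_contra hne
  obtain ⟨a, b, δ, hδ, hab⟩ := hS.exists_persistent (sub_ne_zero.2 hne)
  obtain ⟨c, hc, hRc⟩ := exists_le_of_posDef hR
  obtain ⟨r, hr⟩ : ∃ r, B *ᵥ r ≠ 0 := by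
    by_contra! hcon
    refine hB ?_
    ext i j
    simpa using congrFun (hcon (Pi.single j 1)) i
  -- A Hurwitz matrix is invertible, so Br ≠ 0 yields a nonzero equilibrium: with ν = r − Kξ, Aξ +
  -- Bν = (A − BK)ξ + Br = 0.
  set ξ := -((A - B * K)⁻¹ *ᵥ (B *ᵥ r)) with hξdef
  have hF : (A - B * K) *ᵥ ξ = -(B *ᵥ r) := by
    rw [hξdef, Matrix.mulVec_neg, Matrix.mulVec_mulVec,
      Matrix.mul_nonsing_inv _ ((Matrix.isUnit_iff_isUnit_det _).1 hK.isUnit), Matrix.one_mulVec]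
  have hξ0 : ξ ≠ 0 := fun h0 => hr (by
    rw [h0, Matrix.mulVec_zero] at hF
    exact neg_eq_zero.1 hF.symm)
  set ν := r - K *ᵥ ξ
  have hξν : A *ᵥ ξ + B *ᵥ ν = 0 := by
    rw [Matrix.sub_mulVec, ← Matrix.mulVec_mulVec, sub_eq_iff_eq_add] at hF
    rw [hF, Matrix.mulVec_sub]
    abel
  set κ := (C *ᵥ ξ) ⬝ᵥ (Q *ᵥ (C *ᵥ ξ)) + ν ⬝ᵥ (R *ᵥ ν) with hκ
  have hκ0 : 0 ≤ κ := add_nonneg (posDef_nonneg hQ _) (posDef_nonneg hR _)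
  -- Scaling the equilibrium by ε scales its running cost by ε². The factor 4c is twice the 2c of
  -- `eventually_lt`, as the inequalities for a and b get added; κ + 1 avoids division by zero.
  obtain ⟨ε, hε, hεδ⟩ : ∃ ε : ℝ, 0 < ε ∧ 4 * c * (ε ^ 2 * κ) ≤ δ := by
    refine ⟨Real.sqrt (δ / (4 * c * (κ + 1))), Real.sqrt_pos.2 (by positivity), ?_⟩
    rw [Real.sq_sqrt (by positivity)]
    have : 4 * c * (δ / (4 * c * (κ + 1)) * κ) = δ * (κ / (κ + 1)) := by field_simp
    rw [this]
    exact mul_le_of_le_one_right hδ.le ((div_le_one (by positivity)).2 (by linarith))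
  have hev := fun w₀ => hopt.eventually_lt hQ hR hS hK h hc (fun v => (hRc v).1)
    (ξ := ε • ξ) (ν := ε • ν) (by
      rw [Matrix.mulVec_smul, Matrix.mulVec_smul, ← smul_add, hξν, smul_zero])
    (smul_ne_zero hε.ne' hξ0) w₀
  have hscale : (C *ᵥ (ε • ξ)) ⬝ᵥ (Q *ᵥ (C *ᵥ (ε • ξ))) + (ε • ν) ⬝ᵥ (R *ᵥ (ε • ν)) =
      ε ^ 2 * κ := by
    simp only [Matrix.mulVec_smul, smul_dotProduct, dotProduct_smul, smul_eq_mul, hκ]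
    ring
  obtain ⟨T, hT, hTa, hTb⟩ := ((eventually_ge_atTop (0 : ℝ)).and ((hev a).and (hev b))).exists
  rw [hscale] at hTa hTb
  have hN : ∀ w₀ : Fin q → ℝ, IntervalIntegrable (fun t =>
      ((G' - G) *ᵥ exoState S w₀ t) ⬝ᵥ ((G' - G) *ᵥ exoState S w₀ t)) volume 0 T := fun w₀ => by
    have hcont : Continuous fun y : Fin q → ℝ => ((G' - G) *ᵥ y) ⬝ᵥ ((G' - G) *ᵥ y) := by
      fun_prop
    exact (hcont.comp (continuous_exoState S w₀)).intervalIntegrable _ _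
  -- Only the sum of the outputs from a and b is constant, so both initial states are used; its
  -- integral is Tδ, whereas the two bounds make it less than Tδ.
  have hsum := intervalIntegral.integral_add (hN a) (hN b)
  simp only [hab, intervalIntegral.integral_const, sub_zero, smul_eq_mul] at hsum
  have hfin := mul_le_mul_of_nonneg_left hεδ hT
  linarith

end ControlUniqueness
end OptSync

/-! ### The characterization. -/

theorem mainTheorem1 {n m p q : ℕ}
    (A : Matrix (Fin n) (Fin n) ℝ) (B : Matrix (Fin n) (Fin m) ℝ) (C : Matrix (Fin p) (Fin n) ℝ)
    (Q : Matrix (Fin p) (Fin p) ℝ) (R : Matrix (Fin m) (Fin m) ℝ)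
    (S : Matrix (Fin q) (Fin q) ℝ) (D : Matrix (Fin p) (Fin q) ℝ)
    (hQ : Q.PosDef) (hR : R.PosDef) (hB : B ≠ 0)
    (hstab : OptSync.IsStabilizable A B) (hdet : OptSync.IsDetectable A C)
    (hS : OptSync.HasSemisimpleImaginarySpectrum S) :
    (∃! X : Matrix (Fin n) (Fin q) ℝ × Matrix (Fin n) (Fin q) ℝ × Matrix (Fin m) (Fin q) ℝ,
      OptSync.SolvesHamiltonianSylvester A B C Q R S D X.1 X.2.1 X.2.2) ∧
    ∀ K : Matrix (Fin m) (Fin n) ℝ, OptSync.IsHurwitz (A - B * K) →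
      ∀ (P : Matrix (Fin n) (Fin q) ℝ) (G : Matrix (Fin m) (Fin q) ℝ),
        OptSync.IsOptimalStationarySync A B C Q R S D K P G ↔
          ∃ L : Matrix (Fin n) (Fin q) ℝ,
            OptSync.SolvesHamiltonianSylvester A B C Q R S D P L G := by
  have hex := OptSync.existsUnique_solvesHamiltonianSylvester hQ hR hstab hdet hS D
  refine ⟨hex, fun K hK P G => ⟨fun hopt => ?_, ?_⟩⟩
  · obtain ⟨⟨P₀, L₀, G₀⟩, h₀, -⟩ := hex
    -- The state parts are identified before the gains, since `control_unique` compares gains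
    -- belonging to the same P.
    obtain rfl := hopt.state_unique hS hK (h₀.isOptimalStationarySync hQ hR hdet hS hK)
    obtain rfl := hopt.control_unique hQ hR hB hS hK h₀
    exact ⟨L₀, h₀⟩
  · rintro ⟨L, h⟩
    exact h.isOptimalStationarySync hQ hR hdet hS hK
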